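/- Write $H=L^2(\mathbb R)$, $V=H^1(\mathbb R)$ with $\|v\|_V^2=\|v\|_H^2+\|\partial_x v\|_H^2$, and $V^*$ for the dual of $V$, with $V\hookrightarrow H=H^*\hookrightarrow V^*$. For $T>0$ let $W(V)=\{y\in L^2(0,T;V) : \partial_t y\in L^2(0,T;V^*)\}$ with norm $\|y\|_{W(V)}^2=\|y\|_{L^2(0,T;V)}^2+\|\partial_t y\|_{L^2(0,T;V^*)}^2$; elements of $W(V)$ have a representative in $C([0,T];H)$, which defines $y(0)$. **Theorem.** Let $\nu>0$, $T>0$ and $\chi_c\in C_c^\infty(\mathbb R)$. There exists a constant $C>0$, depending only on $\nu$, $T$ and $\chi_c$, such that the following holds. Let $u\in H^1(0,T)$, let $y_0\in V$ have bounded support, and let $y\in W(V)\cap L^\infty(0,T;V)$ be a weak solution of the viscous Burgers equation $\partial_t y+y\,\partial_x y-\nu\,\partial_{xx}y=\chi_c u$ in $\mathbb R\times(0,T)$, $y(\cdot,0)=y_0$, that is, for all $\phi\in V$ and $\psi\in H$, $$\frac{d}{dt}\langle y(t),\phi\rangle_H+\langle y(t)\,\partial_x y(t),\phi\rangle_H+\nu\langle\partial_x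 y(t),\partial_x\phi\rangle_H=\langle \chi_c\,u(t),\phi\rangle_H\quad\text{for a.e. }t\in(0,T),\qquad \langle y(0),\psi\rangle_H=\langle y_0,\psi\rangle_H .$$ Then $$\|y\|_{L^\infty(0,T;V)}+\|y\|_{W(V)}\le C\,\bigl(\|u\|_{L^2(0,T)}+\|y_0\|_V\bigr)\,\exp\Bigl(C\bigl(\|u\|_{L^2(0,T)}^2+\|y_0\|_H^2\bigr)\Bigr).$$ -/

import Mathlib

open MeasureTheory Set
open scoped ContDiff

noncomputable section

namespace Burgers

/-- `g` is the weak (distributional) derivative of `f` on the open set `Ω ⊆ ℝ`; the functions may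
take values in a Banach space. Both are locally integrable on `Ω`, and
`∫ φ' f = -∫ φ g` for every `φ ∈ C_c^∞(Ω)`. -/
def HasWeakDerivOn {F : Type*} [NormedAddCommGroup F] [NormedSpace ℝ F]
    (Ω : Set ℝ) (f g : ℝ → F) : Prop :=
  LocallyIntegrableOn f Ω ∧ LocallyIntegrableOn g Ω ∧
    ∀ φ : ℝ → ℝ, ContDiff ℝ ∞ φ → HasCompactSupport φ → tsupport φ ⊆ Ω →
      ∫ x in Ω, deriv φ x • f x = -∫ x in Ω, φ x • g x

/-- The space `H = L²(ℝ)`. -/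
abbrev H : Type := Lp ℝ 2 (volume : Measure ℝ)

theorem locallyIntegrable_H (f : H) : LocallyIntegrable f volume :=
  (Lp.memLp f).locallyIntegrable one_le_two

theorem integrable_smul_H {φ : ℝ → ℝ} (hφ : Continuous φ) (hc : HasCompactSupport φ) (f : H) :
    Integrable (fun x => φ x • f x) volume :=
  (locallyIntegrable_H f).integrable_smul_left_of_hasCompactSupport hφ hc

/-- The Sobolev space `V = H¹(ℝ)`, realised as the space of all pairs `(f, f')` in
`L²(ℝ) × L²(ℝ)` in which `f'` is the weak derivative of `f`. The norm inherited from the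
`ℓ²`-product is `‖f‖_V = (‖f‖_H² + ‖f'‖_H²)^{1/2}`. -/
def H1 : Submodule ℝ (WithLp 2 (H × H)) where
  carrier := {p | HasWeakDerivOn univ (p.fst : ℝ → ℝ) (p.snd : ℝ → ℝ)}
  zero_mem' := by
    refine ⟨(locallyIntegrable_H _).locallyIntegrableOn _,
      (locallyIntegrable_H _).locallyIntegrableOn _, fun φ _ _ _ => ?_⟩
    simp
  add_mem' := by
    rintro p q ⟨-, -, hp⟩ ⟨-, -, hq⟩
    refine ⟨(locallyIntegrable_H _).locallyIntegrableOn _,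
      (locallyIntegrable_H _).locallyIntegrableOn _, fun φ h1 h2 h3 => ?_⟩
    have key : ∀ a : ℝ → ℝ, Continuous a → HasCompactSupport a → ∀ f g : H,
        ∫ x in univ, a x • ((f + g : H) : ℝ → ℝ) x
          = (∫ x in univ, a x • f x) + ∫ x in univ, a x • g x := by
      intro a ha hc f g
      rw [← integral_add (integrable_smul_H ha hc f).integrableOn
        (integrable_smul_H ha hc g).integrableOn]
      apply integral_congr_ae
      filter_upwards [ae_restrict_of_ae (Lp.coeFn_add f g)] with x hx
      simp only [hx, Pi.add_apply, smul_add]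
    have e1 := key (deriv φ) (h1.continuous_deriv (by simp)) h2.deriv p.fst q.fst
    have e2 := key φ h1.continuous h2 p.snd q.snd
    have hp' := hp φ h1 h2 h3
    have hq' := hq φ h1 h2 h3
    rw [WithLp.add_fst, WithLp.add_snd, e1, e2, hp', hq', neg_add]
  smul_mem' := by
    rintro c p ⟨-, -, hp⟩
    refine ⟨(locallyIntegrable_H _).locallyIntegrableOn _,
      (locallyIntegrable_H _).locallyIntegrableOn _, fun φ h1 h2 h3 => ?_⟩
    have key : ∀ a : ℝ → ℝ, ∀ f : H,
        ∫ x in univ, a x • ((c • f : H) : ℝ → ℝ) x = c * ∫ x in univ, a x • f x := by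
      intro a f
      rw [← integral_const_mul]
      apply integral_congr_ae
      filter_upwards [ae_restrict_of_ae (Lp.coeFn_smul c f)] with x hx
      simp only [hx, Pi.smul_apply, smul_eq_mul]
      ring
    rw [WithLp.smul_fst, WithLp.smul_snd, key, key, hp φ h1 h2 h3, mul_neg]

/-- The space `V = H¹(ℝ)` as a type, with the `H¹` norm. -/
abbrev V : Type := ↥H1

/-- The embedding `V ↪ H`. -/
def toH : V →L[ℝ] H := (WithLp.fstL 2 ℝ H H).comp H1.subtypeL

/-- The weak derivative `∂ₓ : V → H`. -/
def dx : V →L[ℝ] H := (WithLp.sndL 2 ℝ H H).comp H1.subtypeL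

/-- The dual space `V*` with the operator norm. -/
abbrev VDual : Type := V →L[ℝ] ℝ

/-- The embedding `V ↪ H = H* ↪ V*`, that is `v ↦ ⟨v, ·⟩_H`. -/
def toDual (v : V) : VDual := (innerSL ℝ (toH v)).comp toH

/-- `v ∈ V` has bounded support: it vanishes a.e. outside a compact interval. -/
def HasBoundedSupport (v : V) : Prop :=
  ∃ a b : ℝ, a ≤ b ∧ ∀ᵐ x : ℝ, x ∉ Icc a b → toH v x = 0

/-- Lebesgue measure on the time interval `(0, T)`. -/
abbrev timeMeasure (T : ℝ) : Measure ℝ := volume.restrict (Ioo 0 T)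

/-- The norm of `L^p(0,T;E)` (for `f` in that space). -/
def normLp {E : Type*} [NormedAddCommGroup E] (p : ENNReal) (T : ℝ) (f : ℝ → E) : ℝ :=
  (eLpNorm f p (timeMeasure T)).toReal

/-- `u ∈ H¹(0,T)`. -/
def MemH1Time (T : ℝ) (u : ℝ → ℝ) : Prop :=
  MemLp u 2 (timeMeasure T) ∧
    ∃ du : ℝ → ℝ, MemLp du 2 (timeMeasure T) ∧ HasWeakDerivOn (Ioo 0 T) u du

/-- `y ∈ W(V)` with time derivative `dy`: `y ∈ L²(0,T;V)`, `dy ∈ L²(0,T;V*)` and `dy` is the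
weak derivative in time of `y`, regarded as a function with values in `V*`. -/
structure MemW (T : ℝ) (y : ℝ → V) (dy : ℝ → VDual) : Prop where
  memLp : MemLp y 2 (timeMeasure T)
  memLp_deriv : MemLp dy 2 (timeMeasure T)
  hasWeakDeriv : HasWeakDerivOn (Ioo 0 T) (fun t => toDual (y t)) dy

/-- The norm `‖y‖_{W(V)} = (‖y‖_{L²(V)}² + ‖∂_t y‖_{L²(V*)}²)^{1/2}`, where `dy = ∂_t y`. -/
def normW (T : ℝ) (y : ℝ → V) (dy : ℝ → VDual) : ℝ :=
  Real.sqrt (normLp 2 T y ^ 2 + normLp 2 T dy ^ 2)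

/-- The initial condition `⟨y(0), ψ⟩_H = ⟨y₀, ψ⟩_H` for all `ψ ∈ H`, where `y(0)` is the value at
`t = 0` of the representative of `y` in `C([0,T]; H)`. -/
def HasInitialValue (T : ℝ) (y : ℝ → V) (y₀ : V) : Prop :=
  ∃ z : ℝ → H, ContinuousOn z (Icc 0 T) ∧ (∀ᵐ t ∂timeMeasure T, toH (y t) = z t) ∧
    ∀ ψ : H, inner ℝ (z 0) ψ = inner ℝ (toH y₀) ψ

/-- The weak form of `∂_t y + y ∂ₓy - ν ∂ₓₓy = χ u` with `y(0) = y₀`: for every `φ ∈ V`, the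
scalar function `t ↦ ⟨y(t), φ⟩_H` has a weak derivative `w` on `(0,T)`, and for a.e. `t ∈ (0,T)`
`w(t) + ⟨y(t) ∂ₓy(t), φ⟩_H + ν ⟨∂ₓy(t), ∂ₓφ⟩_H = ⟨χ u(t), φ⟩_H`. -/
structure IsWeakSolution (ν T : ℝ) (χ u : ℝ → ℝ) (y₀ : V) (y : ℝ → V) : Prop where
  equation : ∀ φ : V, ∃ w : ℝ → ℝ,
    HasWeakDerivOn (Ioo 0 T) (fun t => inner ℝ (toH (y t)) (toH φ)) w ∧
    ∀ᵐ t ∂timeMeasure T,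
      w t + (∫ x, (toH (y t) x * dx (y t) x) * toH φ x) + ν * inner ℝ (dx (y t)) (dx φ)
        = ∫ x, (χ x * u t) * toH φ x
  initial : HasInitialValue T y y₀

end Burgers

end

/-! The estimate comes from testing the equation twice. Testing with $y$ removes the convection
term, since $y^2\partial_x y=\partial_x(y^3)/3$ integrates to zero (`inner_convection_self`); Young
and Gronwall then bound $\|y(t)\|_H^2$ and $\int_0^T\|\partial_x y\|_H^2$ by a constant times
$\|u\|^2+\|y_0\|_H^2$. Testing, formally, with $-\partial_{xx}y$ produces the dissipation
$\nu\|\partial_{xx}y\|_H^2$, into which source and convection are absorbed. By Agmon's inequality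
`ae_sq_le`, $\|y\,\partial_x y\|_H^2\le 2\|y\|_H\|\partial_x y\|_H\,\|\partial_x y\|_H^2$, so
Gronwall applies to $\|\partial_x y\|_H^2$ with weight $\frac2\nu\|y\|_H\|\partial_x y\|_H$. The
first estimate bounds the time integral of this weight, which is why only $\|u\|^2+\|y_0\|_H^2$
enters the exponential (`ae_sq_norm_dx_le`).

Two points need care. As $y(t)$ is only in $V$, $-\partial_{xx}y$ is replaced by $D_h^*D_hy$ with a
difference quotient $D_h$; the bounds do not depend on $h$, and Fatou's lemma returns to $\partial_x
y$ (`norm_dx_sq_le_of_diffQuot`). The chain rule for $\|y\|_H^2$ and $\|D_hy\|_H^2$ is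
`energy_identity`, obtained from convexity of the squared norm without regularising in time.

Finally the equation itself, valid in $V^*$ at a.e. time (`IsWeakSolution.ae_equation`), bounds
$\partial_t y$ (`norm_le_of_equation`). -/

noncomputable section

namespace Burgers

open Filter Topology

/-! ### Weak derivatives on intervals -/

section DuBoisReymond

variable {F : Type*} [NormedAddCommGroup F] [NormedSpace ℝ F]

/-- A smooth approximation of the Heaviside function, the primitive of a normalised bump. -/
def smoothStep (ρ : ContDiffBump (0 : ℝ)) (x : ℝ) : ℝ :=
  ∫ r in (-ρ.rOut)..x, ρ.normed volume r

variable (ρ : ContDiffBump (0 : ℝ))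

theorem hasDerivAt_smoothStep (x : ℝ) :
    HasDerivAt (smoothStep ρ) (ρ.normed volume x) x :=
  intervalIntegral.integral_hasDerivAt_right
    (ρ.continuous_normed.intervalIntegrable _ _)
    (ρ.continuous_normed.stronglyMeasurableAtFilter _ _)
    ρ.continuous_normed.continuousAt

theorem contDiff_smoothStep : ContDiff ℝ ∞ (smoothStep ρ) := by
  rw [contDiff_infty_iff_deriv]
  refine ⟨fun x => (hasDerivAt_smoothStep ρ x).differentiableAt, ?_⟩
  have : deriv (smoothStep ρ) = ρ.normed volume :=
    funext fun x => (hasDerivAt_smoothStep ρ x).deriv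
  rw [this]
  exact ρ.contDiff_normed (n := ⊤)

theorem normed_eq_zero {x : ℝ} (hx : ρ.rOut ≤ |x|) : ρ.normed volume x = 0 := by
  have : x ∉ Function.support (ρ.normed volume) := by
    rw [ρ.support_normed_eq]
    simpa using hx
  simpa using this

theorem smoothStep_of_le {x : ℝ} (hx : x ≤ -ρ.rOut) : smoothStep ρ x = 0 := by
  refine (intervalIntegral.integral_congr (g := fun _ => (0 : ℝ)) fun r hr => ?_).trans
    intervalIntegral.integral_zero
  rw [uIcc_of_ge hx] at hr
  exact normed_eq_zero ρ ((by linarith [hr.2] : ρ.rOut ≤ -r).trans (neg_le_abs r))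

theorem smoothStep_of_ge {x : ℝ} (hx : ρ.rOut ≤ x) : smoothStep ρ x = 1 := by
  have h0 := ρ.rOut_pos
  rw [smoothStep, intervalIntegral.integral_of_le (by linarith),
    ← ρ.integral_normed (μ := volume), setIntegral_eq_integral_of_forall_compl_eq_zero]
  intro r hr
  refine normed_eq_zero ρ ?_
  by_contra! h
  rw [abs_lt] at h
  exact hr ⟨h.1, by linarith⟩

theorem smoothStep_mem_Icc (x : ℝ) : smoothStep ρ x ∈ Icc (0 : ℝ) 1 := by
  have hm : Monotone (smoothStep ρ) := monotone_of_hasDerivAt_nonneg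
    (fun x => hasDerivAt_smoothStep ρ x) fun x => ρ.nonneg_normed x
  constructor
  · rw [← smoothStep_of_le ρ (min_le_right x (-ρ.rOut))]
    exact hm (min_le_left _ _)
  · rw [← smoothStep_of_ge ρ (le_max_right x ρ.rOut)]
    exact hm (le_max_left _ _)

/-- A shrinking sequence of bump functions. -/
def bumpSeq (n : ℕ) : ContDiffBump (0 : ℝ) where
  rIn := 1 / (n + 1)
  rOut := 2 / (n + 1)
  rIn_pos := by positivity
  rIn_lt_rOut := by gcongr; norm_num

theorem tendsto_bumpSeq_rOut : Tendsto (fun n => (bumpSeq n).rOut) atTop (𝓝 0) := by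
  have := (tendsto_one_div_add_atTop_nhds_zero_nat (𝕜 := ℝ)).const_mul 2
  simpa [bumpSeq, div_eq_mul_inv] using this

theorem convolution_normed_eq (f : ℝ → F) (s : ℝ) :
    convolution (ρ.normed volume) f (ContinuousLinearMap.lsmul ℝ ℝ) volume s
      = ∫ x, ρ.normed volume (x - s) • f x := by
  rw [convolution_eq_swap]
  congr 1 with x
  rw [← neg_sub, ρ.normed_neg]
  rfl

/-- The test function approximating the indicator of `[s, t]`. -/
def plateau (s t x : ℝ) : ℝ := smoothStep ρ (x - s) - smoothStep ρ (x - t)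

theorem hasDerivAt_plateau (s t x : ℝ) : HasDerivAt (plateau ρ s t)
    (ρ.normed volume (x - s) - ρ.normed volume (x - t)) x :=
  ((hasDerivAt_smoothStep ρ _).comp_sub_const x s).sub
    ((hasDerivAt_smoothStep ρ _).comp_sub_const x t)

theorem contDiff_plateau (s t : ℝ) : ContDiff ℝ ∞ (plateau ρ s t) :=
  ((contDiff_smoothStep ρ).comp (contDiff_id.sub contDiff_const)).sub
    ((contDiff_smoothStep ρ).comp (contDiff_id.sub contDiff_const))

theorem plateau_eq_zero {s t x : ℝ} (hst : s ≤ t)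
    (hx : x ∉ Icc (s - ρ.rOut) (t + ρ.rOut)) : plateau ρ s t x = 0 := by
  rw [mem_Icc, not_and_or, not_le, not_le] at hx
  rw [plateau]
  rcases hx with hx | hx
  · rw [smoothStep_of_le ρ (by linarith), smoothStep_of_le ρ (by linarith), sub_zero]
  · rw [smoothStep_of_ge ρ (by linarith), smoothStep_of_ge ρ (by linarith), sub_self]

theorem tsupport_plateau_subset {s t : ℝ} (hst : s ≤ t) :
    tsupport (plateau ρ s t) ⊆ Icc (s - ρ.rOut) (t + ρ.rOut) :=
  closure_minimal (fun x hx => by by_contra h; exact hx (plateau_eq_zero ρ hst h)) isClosed_Icc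

theorem abs_plateau_le (s t x : ℝ) : |plateau ρ s t x| ≤ 1 := by
  have h1 := smoothStep_mem_Icc ρ (x - s)
  have h2 := smoothStep_mem_Icc ρ (x - t)
  rw [plateau, abs_le]
  constructor <;> linarith [h1.1, h1.2, h2.1, h2.2]

/-- Dominated convergence: away from the two endpoints the plateau eventually equals the indicator
of $(s,t]$, and all plateaus live in one compact interval because the outer radii are at most 2. -/
theorem tendsto_integral_plateau_smul {g : ℝ → F} (hg : LocallyIntegrable g) {s t : ℝ}
    (hst : s < t) : Tendsto (fun n => ∫ x, plateau (bumpSeq n) s t x • g x) atTop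
      (𝓝 (∫ x in s..t, g x)) := by
  rw [intervalIntegral.integral_of_le hst.le, ← integral_indicator measurableSet_Ioc]
  have hK : ∀ n, (bumpSeq n).rOut ≤ 2 := fun n => by
    simp only [bumpSeq]
    rw [div_le_iff₀ (by positivity)]
    have : (0 : ℝ) ≤ n := n.cast_nonneg
    linarith
  refine tendsto_integral_of_dominated_convergence
    (fun x => (Icc (s - 2) (t + 2)).indicator (fun x => ‖g x‖) x) (fun n => ?_) ?_
    (fun n => .of_forall fun x => ?_) ?_
  · exact ((contDiff_plateau _ s t).continuous.aestronglyMeasurable).smul hg.aestronglyMeasurable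
  · rw [integrable_indicator_iff measurableSet_Icc]
    exact (hg.integrableOn_isCompact isCompact_Icc).norm
  · by_cases hx : x ∈ Icc (s - 2) (t + 2)
    · rw [indicator_of_mem hx, norm_smul]
      exact mul_le_of_le_one_left (norm_nonneg _) (abs_plateau_le _ s t x)
    · rw [indicator_of_notMem hx, plateau_eq_zero _ hst.le
        (fun h => hx ⟨by linarith [h.1, hK n], by linarith [h.2, hK n]⟩), zero_smul, norm_zero]
  · have hs : ∀ᵐ x : ℝ, x ≠ s := by simp [ae_iff, measure_singleton]
    have ht : ∀ᵐ x : ℝ, x ≠ t := by simp [ae_iff, measure_singleton]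
    filter_upwards [hs, ht] with x hxs hxt
    have hd : 0 < min |x - s| |x - t| := lt_min (abs_pos.2 (sub_ne_zero.2 hxs))
      (abs_pos.2 (sub_ne_zero.2 hxt))
    refine tendsto_const_nhds.congr' ?_
    filter_upwards [tendsto_bumpSeq_rOut.eventually_lt_const hd] with n hn
    have h1 := hn.trans_le (min_le_left _ _)
    have h2 := hn.trans_le (min_le_right _ _)
    rcases lt_or_gt_of_ne hxs with h | h
    · rw [abs_of_neg (by linarith)] at h1
      rw [indicator_of_notMem (fun hx => by linarith [hx.1]),
        plateau_eq_zero _ hst.le (fun hx => by linarith [hx.1]), zero_smul]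
    rw [abs_of_pos (by linarith)] at h1
    rcases lt_or_gt_of_ne hxt with h' | h'
    · rw [abs_of_neg (by linarith)] at h2
      rw [indicator_of_mem (show x ∈ Ioc s t from ⟨h, h'.le⟩), plateau,
        smoothStep_of_ge _ (by linarith), smoothStep_of_le _ (by linarith), sub_zero, one_smul]
    · rw [abs_of_pos (by linarith)] at h2
      rw [indicator_of_notMem (fun hx => by linarith [hx.2]),
        plateau_eq_zero _ hst.le (fun hx => by linarith [hx.2]), zero_smul]

variable [CompleteSpace F]

/-- A function on an open interval is, up to a null set, a primitive of its weak derivative. -/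
theorem exists_ae_sub_eq_integral {Ω : Set ℝ} (hΩ : IsOpen Ω) (hc : OrdConnected Ω)
    {f g : ℝ → F} (hf : LocallyIntegrable (Ω.indicator f)) (hg : LocallyIntegrable (Ω.indicator g))
    (h : HasWeakDerivOn Ω f g) :
    ∃ G : Set ℝ, (∀ᵐ s, s ∈ G) ∧ ∀ s ∈ G ∩ Ω, ∀ t ∈ G ∩ Ω, f t - f s = ∫ x in s..t, g x := by
  have hconv := ContDiffBump.ae_convolution_tendsto_right_of_locallyIntegrable (μ := volume)
    (φ := bumpSeq) (K := 2) tendsto_bumpSeq_rOut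
    (.of_forall fun n => by simp only [bumpSeq]; rw [← mul_div_assoc, mul_one]) hf
  refine ⟨_, hconv, ?_⟩
  set G := {s | Tendsto (fun n => convolution ((bumpSeq n).normed volume) (Ω.indicator f)
    (ContinuousLinearMap.lsmul ℝ ℝ) volume s) atTop (𝓝 (Ω.indicator f s))}
  -- The derivative of the plateau is a bump at $s$ minus a bump at $t$. Testing with it therefore
  -- equates the difference of the mollifications of $f$ at $t$ and $s$ with $\int
  -- \mathrm{plateau}\cdot g$; at points of $G$ the mollifications converge to $f$.
  have key : ∀ s ∈ G ∩ Ω, ∀ t ∈ G ∩ Ω, s < t → f t - f s = ∫ x in s..t, g x := by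
    rintro s ⟨hs, hsΩ⟩ t ⟨ht, htΩ⟩ hst
    have hs' : Tendsto _ _ _ := hs
    have ht' : Tendsto _ _ _ := ht
    simp only [convolution_normed_eq, indicator_of_mem hsΩ] at hs'
    simp only [convolution_normed_eq, indicator_of_mem htΩ] at ht'
    have hlim := tendsto_integral_plateau_smul hg hst
    have hsub : Icc s t ⊆ Ω := hc.out hsΩ htΩ
    have e : ∫ x in s..t, Ω.indicator g x = ∫ x in s..t, g x := by
      refine intervalIntegral.integral_congr fun x hx => ?_
      rw [uIcc_of_le hst.le] at hx
      exact indicator_of_mem (hsub hx) _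
    rw [e] at hlim
    obtain ⟨ε, hε, hεs⟩ := Metric.isOpen_iff.1 hΩ s hsΩ
    obtain ⟨δ, hδ, hδt⟩ := Metric.isOpen_iff.1 hΩ t htΩ
    refine tendsto_nhds_unique ((ht'.sub hs').congr' ?_) hlim
    filter_upwards [tendsto_bumpSeq_rOut.eventually_lt_const hε,
      tendsto_bumpSeq_rOut.eventually_lt_const hδ] with n hn1 hn2
    have hr := (bumpSeq n).rOut_pos
    have hsupp : tsupport (plateau (bumpSeq n) s t) ⊆ Ω := by
      refine (tsupport_plateau_subset _ hst.le).trans (hc.out (hεs ?_) (hδt ?_))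
      · rw [Metric.mem_ball, Real.dist_eq, sub_sub_cancel_left, abs_neg, abs_of_pos hr]
        exact hn1
      · rw [Metric.mem_ball, Real.dist_eq, add_sub_cancel_left, abs_of_pos hr]
        exact hn2
    have hcs : HasCompactSupport (plateau (bumpSeq n) s t) :=
      isCompact_Icc.of_isClosed_subset (isClosed_tsupport _) (tsupport_plateau_subset _ hst.le)
    have := h.2.2 _ (contDiff_plateau (bumpSeq n) s t) hcs hsupp
    rw [← integral_indicator hΩ.measurableSet, ← integral_indicator hΩ.measurableSet] at this
    simp only [indicator_smul, (hasDerivAt_plateau (bumpSeq n) s t _).deriv] at this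
    simp only [sub_smul] at this
    have hint : ∀ r, Integrable (fun x => (bumpSeq n).normed volume (x - r) • Ω.indicator f x) :=
      fun r => hf.integrable_smul_left_of_hasCompactSupport
        ((bumpSeq n).continuous_normed.comp (continuous_sub_right r))
        ((bumpSeq n).hasCompactSupport_normed.comp_homeomorph (Homeomorph.subRight r))
    rw [integral_sub (hint s) (hint t)] at this
    rw [← neg_sub, this, neg_neg]
  intro s hs t ht
  rcases lt_trichotomy s t with hst | rfl | hst
  · exact key s hs t ht hst
  · simp
  · rw [intervalIntegral.integral_symm, ← key t ht s hs hst, neg_sub]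

end DuBoisReymond

/-! ### Absolutely continuous functions -/

section AbsolutelyContinuous

/-- Transfers absolute continuity from $G$, in practice a primitive of an integrable function, to
anything whose increments it controls. -/
theorem absolutelyContinuousOnInterval_of_dist_le {X : Type*} [PseudoMetricSpace X] {f : ℝ → X}
    {G : ℝ → ℝ} {a b K : ℝ} (hG : AbsolutelyContinuousOnInterval G a b)
    (h : ∀ s ∈ uIcc a b, ∀ t ∈ uIcc a b, dist (f s) (f t) ≤ K * dist (G s) (G t)) :
    AbsolutelyContinuousOnInterval f a b := by
  have hG' := Tendsto.const_mul K hG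
  rw [mul_zero] at hG'
  refine squeeze_zero' (.of_forall fun _ => Finset.sum_nonneg fun _ _ => dist_nonneg) ?_ hG'
  filter_upwards [mem_inf_of_right (mem_principal_self _)] with E hE
  rw [Finset.mul_sum]
  exact Finset.sum_le_sum fun i hi => h _ (hE.1 i hi).1 _ (hE.1 i hi).2

theorem integral_eq_sub_of_ae_hasDerivAt {f f' : ℝ → ℝ} {a b : ℝ}
    (hf : AbsolutelyContinuousOnInterval f a b)
    (h : ∀ᵐ x, x ∈ uIcc a b → HasDerivAt f (f' x) x) : ∫ x in a..b, f' x = f b - f a := by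
  rw [← hf.integral_deriv_eq_sub]
  refine intervalIntegral.integral_congr_ae ?_
  filter_upwards [h] with x hx hx'
  exact (hx (uIoc_subset_uIcc hx')).deriv.symm

theorem intervalIntegrable_of_integrableOn_Ioo {E : Type*} [NormedAddCommGroup E] {f : ℝ → E}
    {T : ℝ} (hf : IntegrableOn f (Ioo 0 T)) {s t : ℝ} (hs : s ∈ Icc 0 T) (ht : t ∈ Icc 0 T) :
    IntervalIntegrable f volume s t := by
  have h0 : (0 : ℝ) ≤ T := hs.1.trans hs.2
  refine IntervalIntegrable.mono_set (a := 0) (b := T) ?_ ?_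
  · rwa [intervalIntegrable_iff_integrableOn_Ioo_of_le h0]
  · rw [uIcc_of_le h0]
    exact uIcc_subset_Icc hs ht

theorem exp_neg_sub_exp_neg_le {a b : ℝ} (ha : 0 ≤ a) (hb : 0 ≤ b) :
    |Real.exp (-a) - Real.exp (-b)| ≤ |a - b| := by
  wlog hab : a ≤ b generalizing a b
  · rw [abs_sub_comm, abs_sub_comm a b]
    exact this hb ha (le_of_not_ge hab)
  have h1 : Real.exp (-b) ≤ Real.exp (-a) := Real.exp_le_exp.2 (by linarith)
  rw [abs_of_nonneg (by linarith), abs_of_nonpos (by linarith)]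
  have h2 : Real.exp (-b) = Real.exp (-a) * Real.exp (a - b) := by
    rw [← Real.exp_add]; ring_nf
  have h3 := Real.add_one_le_exp (a - b)
  have h4 : Real.exp (-a) ≤ 1 := Real.exp_le_one_iff.2 (by linarith)
  have h5 := Real.exp_pos (-a)
  rw [h2]
  nlinarith

/-- Gronwall's inequality in integral form with an integrable weight. -/
theorem ae_le_mul_exp_of_ae_le_add_integral {T A : ℝ} (hT : 0 ≤ T) (hA : 0 ≤ A) {β f : ℝ → ℝ}
    (hβ : IntegrableOn β (Ioo 0 T)) (hβ0 : ∀ t, 0 ≤ β t)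
    (hβf : IntegrableOn (fun t => β t * f t) (Ioo 0 T))
    (h : ∀ᵐ t ∂volume.restrict (Ioo 0 T), f t ≤ A + ∫ s in (0 : ℝ)..t, β s * f s) :
    ∀ᵐ t ∂volume.restrict (Ioo 0 T), f t ≤ A * Real.exp (∫ s in (0 : ℝ)..T, β s) := by
  have h0 : (0 : ℝ) ∈ Icc 0 T := ⟨le_rfl, hT⟩
  have hTT : T ∈ Icc 0 T := ⟨hT, le_rfl⟩
  rw [ae_restrict_iff' measurableSet_Ioo] at h ⊢
  set B : ℝ → ℝ := fun t => ∫ s in (0 : ℝ)..t, β s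
  set Φ : ℝ → ℝ := fun t => A + ∫ s in (0 : ℝ)..t, β s * f s
  have hBnn : ∀ t, 0 ≤ t → 0 ≤ B t := fun t ht =>
    intervalIntegral.integral_nonneg ht fun s _ => hβ0 s
  have hBi := intervalIntegrable_of_integrableOn_Ioo hβ h0 hTT
  have hfi := intervalIntegrable_of_integrableOn_Ioo hβf h0 hTT
  have hBac : AbsolutelyContinuousOnInterval B 0 T :=
    hBi.absolutelyContinuousOnInterval_intervalIntegral left_mem_uIcc
  have hΦac : AbsolutelyContinuousOnInterval Φ 0 T :=
    absolutelyContinuousOnInterval_of_dist_le (K := 1)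
      (hfi.absolutelyContinuousOnInterval_intervalIntegral left_mem_uIcc)
      fun s _ t _ => by simp [Φ]
  have heac : AbsolutelyContinuousOnInterval (fun t => Real.exp (-B t)) 0 T := by
    refine absolutelyContinuousOnInterval_of_dist_le (K := 1) hBac fun s hs t ht => ?_
    rw [uIcc_of_le hT] at hs ht
    rw [one_mul, Real.dist_eq, Real.dist_eq]
    exact exp_neg_sub_exp_neg_le (hBnn s hs.1) (hBnn t ht.1)
  have hder : ∀ᵐ x, x ∈ uIcc 0 T → HasDerivAt (fun t => Φ t * Real.exp (-B t))
      (β x * f x * Real.exp (-B x) + Φ x * (Real.exp (-B x) * -β x)) x := by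
    filter_upwards [hBi.ae_hasDerivAt_integral, hfi.ae_hasDerivAt_integral] with x h1 h2 hx
    exact ((h2 hx 0 left_mem_uIcc).const_add A).mul (h1 hx 0 left_mem_uIcc).neg.exp
  filter_upwards [h] with t ht htT
  have htI : t ∈ Icc 0 T := Ioo_subset_Icc_self htT
  have hsub : uIcc 0 t ⊆ uIcc 0 T := by
    rw [uIcc_of_le hT, uIcc_of_le htI.1]
    exact Icc_subset_Icc_right htI.2
  -- Integrating factor: $(\Phi e^{-B})'=\beta(f-\Phi)e^{-B}\le 0$ a.e. The argument runs on the
  -- absolutely continuous majorant $\Phi$, as $f$ has no regularity in time.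
  have hmono : Φ t * Real.exp (-B t) - Φ 0 * Real.exp (-B 0) ≤ 0 := by
    rw [← integral_eq_sub_of_ae_hasDerivAt ((hΦac.fun_mul heac).mono hsub)
      (hder.mono fun x hx hx' => hx (hsub hx'))]
    rw [intervalIntegral.integral_of_le htI.1, ← integral_Ioc_eq_integral_Ioo.symm]
    refine integral_nonpos_of_ae ?_
    rw [EventuallyLE, ae_restrict_iff' measurableSet_Ioo]
    filter_upwards [h] with s hs hs'
    have := hs ⟨hs'.1, hs'.2.trans htT.2⟩
    have h1 := mul_nonneg (hβ0 s) (Real.exp_pos (-B s)).le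
    simp only [Pi.zero_apply]
    nlinarith
  have hB0 : B 0 = 0 := intervalIntegral.integral_same
  have hΦ0 : Φ 0 = A := by simp [Φ]
  rw [hB0, hΦ0, neg_zero, Real.exp_zero, mul_one, sub_nonpos, Real.exp_neg,
    mul_inv_le_iff₀ (Real.exp_pos _)] at hmono
  refine (ht htT).trans (hmono.trans ?_)
  gcongr
  have : B T - B t = ∫ s in t..T, β s :=
    intervalIntegral.integral_interval_sub_left hBi
      (intervalIntegrable_of_integrableOn_Ioo hβ h0 htI)
  have h2 : 0 ≤ ∫ s in t..T, β s := intervalIntegral.integral_nonneg htI.2 fun s _ => hβ0 s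
  show B t ≤ B T
  linarith

end AbsolutelyContinuous

/-! ### The Sobolev space `H¹(ℝ)` -/

section Sobolev

theorem norm_sq_V (v : V) : ‖v‖ ^ 2 = ‖toH v‖ ^ 2 + ‖dx v‖ ^ 2 := by
  exact WithLp.prod_norm_sq_eq_of_L2 (v : WithLp 2 (H × H))

theorem norm_toH_le (v : V) : ‖toH v‖ ≤ ‖v‖ :=
  le_of_sq_le_sq (by rw [norm_sq_V]; nlinarith [sq_nonneg ‖dx v‖]) (norm_nonneg _)

theorem norm_dx_le (v : V) : ‖dx v‖ ≤ ‖v‖ :=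
  le_of_sq_le_sq (by rw [norm_sq_V]; nlinarith [sq_nonneg ‖toH v‖]) (norm_nonneg _)

theorem inner_eq_integral (f g : H) : inner ℝ f g = ∫ x, f x * g x := by
  rw [L2.inner_def]
  simp [mul_comm]

theorem integrable_mul_H (f g : H) : Integrable (fun x => f x * g x) :=
  (Lp.memLp f).integrable_mul (Lp.memLp g)

theorem norm_sq_eq_integral (f : H) : ‖f‖ ^ 2 = ∫ x, f x ^ 2 := by
  rw [← real_inner_self_eq_norm_sq, inner_eq_integral]
  simp [sq]

theorem integrable_sq_H (f : H) : Integrable (fun x => f x ^ 2) := by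
  simpa [sq] using integrable_mul_H f f

theorem norm_sq_eq_lintegral (f : H) : ENNReal.ofReal (‖f‖ ^ 2) = ∫⁻ x, ENNReal.ofReal (f x ^ 2) := by
  rw [norm_sq_eq_integral, ofReal_integral_eq_lintegral_ofReal (integrable_sq_H f)
    (.of_forall fun x => sq_nonneg _)]

theorem integral_abs_mul_le (f g : H) : ∫ x, |f x * g x| ≤ ‖f‖ * ‖g‖ := by
  have h := real_inner_le_norm |f| |g|
  rw [norm_abs_eq_norm, norm_abs_eq_norm, inner_eq_integral] at h
  refine le_of_eq_of_le (integral_congr_ae ?_) h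
  filter_upwards [Lp.coeFn_abs f, Lp.coeFn_abs g] with x hx hx'
  rw [hx, hx', abs_mul]

theorem intervalIntegrable_of_locallyIntegrable {g : ℝ → ℝ} (hg : LocallyIntegrable g) (a b : ℝ) :
    IntervalIntegrable g volume a b :=
  intervalIntegrable_iff.2 ((hg.integrableOn_isCompact isCompact_uIcc).mono_set uIoc_subset_uIcc)

theorem hasWeakDerivOn_V (v : V) : HasWeakDerivOn univ (toH v) (dx v) := v.2

/-- The absolutely continuous representative of an element of `H¹(ℝ)`. -/
theorem exists_representative (v : V) : ∃ w : ℝ → ℝ, (toH v : ℝ → ℝ) =ᵐ[volume] w ∧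
    ∀ a b, w b - w a = ∫ x in a..b, dx v x := by
  obtain ⟨G, hG, h⟩ := exists_ae_sub_eq_integral isOpen_univ ordConnected_univ
    (by simpa using locallyIntegrable_H (toH v)) (by simpa using locallyIntegrable_H (dx v))
    (hasWeakDerivOn_V v)
  obtain ⟨s, hs⟩ := hG.exists
  have hi : ∀ a b, IntervalIntegrable (dx v) volume a b := fun a b =>
    intervalIntegrable_of_locallyIntegrable (locallyIntegrable_H (dx v)) a b
  refine ⟨fun t => toH v s + ∫ x in s..t, dx v x, ?_, fun a b => ?_⟩
  · filter_upwards [hG] with t ht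
    rw [← h s ⟨hs, trivial⟩ t ⟨ht, trivial⟩]
    ring
  · rw [add_sub_add_left_eq_sub]
    exact intervalIntegral.integral_interval_sub_left (hi _ _) (hi _ _)

section Representative

variable {w g : ℝ → ℝ}

theorem representative_ac (hw : ∀ a b, w b - w a = ∫ x in a..b, g x)
    (hg : LocallyIntegrable g) (a b : ℝ) :
    AbsolutelyContinuousOnInterval w a b :=
  absolutelyContinuousOnInterval_of_dist_le (K := 1)
    ((intervalIntegrable_of_locallyIntegrable hg a b)
      |>.absolutelyContinuousOnInterval_intervalIntegral left_mem_uIcc)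
    fun s _ t _ => by simp only [← hw, Real.dist_eq, sub_sub_sub_cancel_right, one_mul, le_refl]

theorem representative_ae_hasDerivAt (hw : ∀ a b, w b - w a = ∫ x in a..b, g x)
    (hg : LocallyIntegrable g) :
    ∀ᵐ x, HasDerivAt w (g x) x := by
  filter_upwards [LocallyIntegrable.ae_hasDerivAt_integral hg] with x hx
  have h := (hx 0).const_add (w 0)
  simpa [← hw] using h

theorem representative_continuous (hw : ∀ a b, w b - w a = ∫ x in a..b, g x)
    (hg : LocallyIntegrable g) :
    Continuous w := by
  rw [continuous_iff_continuousAt]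
  intro x
  have h := (representative_ac hw hg (x - 1) (x + 1)).continuousOn
  rw [uIcc_of_le (by linarith)] at h
  exact h.continuousAt (Icc_mem_nhds (by linarith) (by linarith))

end Representative

/-- Integrability of $G$ gives limits of $q$ at both ends; a nonzero limit would contradict
integrability of $q$ on a half-line of infinite measure. -/
theorem tendsto_zero_of_integrable_primitive {q G : ℝ → ℝ} (hq : Integrable q) (hG : Integrable G)
    (h : ∀ a b, q b - q a = ∫ x in a..b, G x) :
    Tendsto q atTop (𝓝 0) ∧ Tendsto q atBot (𝓝 0) := by
  have e : ∀ x, q x = q 0 + ∫ x in (0 : ℝ)..x, G x := fun x => by rw [← h]; ring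
  constructor
  · have h1 : Tendsto q atTop (𝓝 (q 0 + ∫ x in Ioi 0, G x)) := by
      refine Tendsto.congr (fun x => (e x).symm) ?_
      exact (intervalIntegral_tendsto_integral_Ioi 0 hG.integrableOn tendsto_id).const_add _
    have h2 := IntegrableAtFilter.eq_zero_of_tendsto (l := atTop) (μ := volume)
      ⟨univ, univ_mem, hq.integrableOn⟩ (fun s hs => ?_) h1
    · rwa [h2] at h1
    · obtain ⟨b, hb⟩ := mem_atTop_sets.1 hs
      rw [← top_le_iff, ← Real.volume_Ici (a := b)]
      exact measure_mono hb
  · have h1 : Tendsto q atBot (𝓝 (q 0 - ∫ x in Iic 0, G x)) := by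
      refine Tendsto.congr (fun x => (e x).symm) ?_
      simp_rw [intervalIntegral.integral_symm _ (0 : ℝ), ← sub_eq_add_neg]
      exact (intervalIntegral_tendsto_integral_Iic 0 hG.integrableOn tendsto_id).const_sub _
    have h2 := IntegrableAtFilter.eq_zero_of_tendsto (l := atBot) (μ := volume)
      ⟨univ, univ_mem, hq.integrableOn⟩ (fun s hs => ?_) h1
    · rwa [h2] at h1
    · obtain ⟨b, hb⟩ := mem_atBot_sets.1 hs
      rw [← top_le_iff, ← Real.volume_Iic (a := b)]
      exact measure_mono hb

/-- Agmon's inequality. -/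
theorem ae_sq_le (v : V) : ∀ᵐ x, toH v x ^ 2 ≤ 2 * (‖toH v‖ * ‖dx v‖) := by
  obtain ⟨w, hvw, hw⟩ := exists_representative v
  have hg := locallyIntegrable_H (dx v)
  have hw2 : ∀ a b, w b ^ 2 - w a ^ 2 = ∫ x in a..b, 2 * (w x * dx v x) := fun a b => by
    have hac := representative_ac hw hg a b
    have := integral_eq_sub_of_ae_hasDerivAt (hac.fun_mul hac)
      ((representative_ae_hasDerivAt hw hg).mono fun x hx _ => hx.mul hx)
    rw [sq, sq, ← this]
    exact intervalIntegral.integral_congr fun x _ => by ring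
  have hi2 : Integrable (fun x => w x ^ 2) :=
    (integrable_sq_H (toH v)).congr (hvw.mono fun x hx => by simp only [hx])
  have hiG : Integrable (fun x => 2 * (w x * dx v x)) :=
    ((integrable_mul_H (toH v) (dx v)).congr
      (hvw.mono fun x hx => by simp only [hx])).const_mul 2
  have hlim := (tendsto_zero_of_integrable_primitive hi2 hiG hw2).2
  filter_upwards [hvw] with x hx
  rw [hx]
  -- Only the left end is used: $w(x)^2-w(a)^2=2\int_a^x ww'$ is at most $2\int_{\mathbb R}|ww'|$,
  -- and $w(a)\to0$ as $a\to-\infty$. This gives the constant 2.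
  have hle : ∀ᶠ a in atBot, w x ^ 2 - w a ^ 2 ≤ 2 * (‖toH v‖ * ‖dx v‖) := by
    filter_upwards [eventually_le_atBot x] with a ha
    rw [hw2, intervalIntegral.integral_const_mul]
    gcongr
    refine le_trans ?_ (integral_abs_mul_le (toH v) (dx v))
    rw [integral_congr_ae (hvw.mono fun x hx => by simp only [hx] :
      (fun x => |toH v x * dx v x|) =ᵐ[volume] fun x => |w x * dx v x|),
      intervalIntegral.integral_of_le ha]
    have hi : Integrable (fun x => w x * dx v x) := by simpa using hiG.const_mul (1 / 2)
    exact (integral_mono hi.integrableOn hi.abs.integrableOn fun x => le_abs_self _).trans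
      (setIntegral_le_integral hi.abs (.of_forall fun x => abs_nonneg _))
  have := le_of_tendsto (tendsto_const_nhds.sub hlim) hle
  simpa using this

theorem two_mul_norm_le (v : V) : 2 * (‖toH v‖ * ‖dx v‖) ≤ ‖v‖ ^ 2 := by
  rw [norm_sq_V]
  nlinarith [sq_nonneg (‖toH v‖ - ‖dx v‖)]

theorem ae_abs_le_norm (v : V) : ∀ᵐ x, |toH v x| ≤ ‖v‖ := by
  filter_upwards [ae_sq_le v] with x hx
  exact abs_le_of_sq_le_sq (hx.trans (two_mul_norm_le v)) (norm_nonneg v)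

theorem memLp_convection (v : V) : MemLp (fun x => toH v x * dx v x) 2 := by
  refine MemLp.of_le_mul (c := ‖v‖) (Lp.memLp (dx v))
    ((Lp.aestronglyMeasurable _).mul (Lp.aestronglyMeasurable _)) ?_
  filter_upwards [ae_abs_le_norm v] with x hx
  rw [norm_mul]
  gcongr
  exact hx

/-- The convection term `v ∂ₓv`, as an element of `L²(ℝ)`. -/
def convection (v : V) : H := (memLp_convection v).toLp

theorem convection_ae (v : V) : (convection v : ℝ → ℝ) =ᵐ[volume] fun x => toH v x * dx v x :=
  (memLp_convection v).coeFn_toLp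

theorem inner_convection (v : V) (f : H) :
    inner ℝ (convection v) f = ∫ x, (toH v x * dx v x) * f x := by
  rw [inner_eq_integral]
  exact integral_congr_ae ((convection_ae v).mono fun x hx => by simp only [hx])

/-- Agmon is applied to the undifferentiated factor; the resulting $\|v\|_H\|\partial_xv\|_H$ later
serves as the Gronwall weight. -/
theorem norm_convection_sq_le (v : V) :
    ‖convection v‖ ^ 2 ≤ 2 * (‖toH v‖ * ‖dx v‖) * ‖dx v‖ ^ 2 := by
  rw [norm_sq_eq_integral, norm_sq_eq_integral (dx v), ← integral_const_mul]
  refine integral_mono_ae (integrable_sq_H _) ((integrable_sq_H _).const_mul _) ?_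
  filter_upwards [ae_sq_le v, convection_ae v] with x hx hx'
  rw [hx', mul_pow]
  gcongr

/-- The supremum is taken on the test function, so that convection is bounded in $V^*$ by
$\|v\|_H\|\partial_xv\|_H$. -/
theorem abs_inner_convection_le (v φ : V) :
    |inner ℝ (convection v) (toH φ)| ≤ ‖toH v‖ * ‖dx v‖ * ‖φ‖ := by
  rw [inner_convection, mul_comm (‖toH v‖ * ‖dx v‖)]
  calc |∫ x, (toH v x * dx v x) * toH φ x|
      ≤ ∫ x, |(toH v x * dx v x) * toH φ x| := abs_integral_le_integral_abs
    _ ≤ ∫ x, ‖φ‖ * |toH v x * dx v x| := by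
        refine integral_mono_ae ?_ ((integrable_mul_H _ _).abs.const_mul _) ?_
        · exact ((integrable_mul_H (convection v) (toH φ)).congr
            ((convection_ae v).mono fun x hx => by simp only [hx])).abs
        · filter_upwards [ae_abs_le_norm φ] with x hx
          rw [abs_mul, mul_comm]
          gcongr
    _ ≤ ‖φ‖ * (‖toH v‖ * ‖dx v‖) := by
        rw [integral_const_mul]
        gcongr
        exact integral_abs_mul_le _ _

/-- The integrand is $(w^3)'/3$ for the absolutely continuous representative $w$. Since
$|w|^3\le\|v\|_V\,w^2$ is integrable, $w^3$ vanishes at both ends. -/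
theorem inner_convection_self (v : V) : inner ℝ (convection v) (toH v) = 0 := by
  obtain ⟨w, hvw, hw⟩ := exists_representative v
  have hg := locallyIntegrable_H (dx v)
  have hw3 : ∀ a b, w b ^ 3 - w a ^ 3 = ∫ x in a..b, 3 * (w x * dx v x * w x) := fun a b => by
    have hac := representative_ac hw hg a b
    have := integral_eq_sub_of_ae_hasDerivAt ((hac.fun_mul hac).fun_mul hac)
      ((representative_ae_hasDerivAt hw hg).mono fun x hx _ => (hx.mul hx).mul hx)
    rw [pow_three', pow_three', ← this]
    exact intervalIntegral.integral_congr fun x _ => by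
      simp only [Pi.mul_apply]; ring
  have e : (fun x => convection v x * toH v x) =ᵐ[volume] fun x => w x * dx v x * w x := by
    filter_upwards [hvw, convection_ae v] with x hx hx'
    rw [hx', hx]
  have hiG : Integrable (fun x => 3 * (w x * dx v x * w x)) :=
    ((integrable_mul_H _ _).congr e).const_mul 3
  have hi3 : Integrable (fun x => w x ^ 3) := by
    refine Integrable.mono' (g := fun x => ‖v‖ * toH v x ^ 2) ((integrable_sq_H _).const_mul _)
      ((representative_continuous hw hg).pow 3).aestronglyMeasurable ?_
    filter_upwards [hvw, ae_abs_le_norm v] with x hx hx'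
    rw [hx] at hx' ⊢
    rw [Real.norm_eq_abs, abs_pow, pow_succ', sq_abs]
    gcongr
  obtain ⟨h1, h2⟩ := tendsto_zero_of_integrable_primitive hi3 hiG hw3
  have h3 := intervalIntegral_tendsto_integral hiG tendsto_neg_atTop_atBot tendsto_id
  have h4 : Tendsto (fun R : ℝ => w R ^ 3 - w (-R) ^ 3) atTop (𝓝 (0 - 0)) :=
    h1.sub (h2.comp tendsto_neg_atTop_atBot)
  simp only [← hw3, id] at h3
  have h5 := tendsto_nhds_unique h3 h4
  rw [integral_const_mul] at h5
  rw [inner_eq_integral, integral_congr_ae e]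
  linarith

end Sobolev

/-! ### Translations and difference quotients -/

section Translation

/-- Translation by `h` on `L²(ℝ)`. -/
def shift (h : ℝ) : H →ₗᵢ[ℝ] H :=
  Lp.compMeasurePreservingₗᵢ ℝ (fun x => x + h) (measurePreserving_add_right volume h)

theorem shift_ae (h : ℝ) (f : H) : (shift h f : ℝ → ℝ) =ᵐ[volume] fun x => f (x + h) :=
  Lp.coeFn_compMeasurePreserving f (measurePreserving_add_right volume h)

theorem shift_shift_neg (h : ℝ) (f : H) : shift h (shift (-h) f) = f := by
  refine Lp.ext ?_
  have := (measurePreserving_add_right volume h).quasiMeasurePreserving.ae (shift_ae (-h) f)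
  filter_upwards [shift_ae h (shift (-h) f), this] with x h1 h2
  rw [h1, h2, add_neg_cancel_right]

theorem inner_shift (h : ℝ) (f g : H) : inner ℝ (shift h f) g = inner ℝ f (shift (-h) g) := by
  conv_lhs => rw [← shift_shift_neg h g]
  exact (shift h).inner_map_map f _

theorem integral_mul_shift (a : ℝ → ℝ) (h : ℝ) (f : H) :
    ∫ x, a x • shift h f x = ∫ x, a (x - h) • f x := by
  rw [integral_congr_ae ((shift_ae h f).mono fun x hx => by simp only [hx] :
    (fun x => a x • shift h f x) =ᵐ[volume] fun x => a x • f (x + h)),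
    ← integral_add_right_eq_self (fun x => a (x - h) • f x) h]
  simp

theorem shift_mem_H1 (h : ℝ) (v : V) :
    WithLp.toLp 2 (shift h (toH v), shift h (dx v)) ∈ H1 := by
  refine ⟨(locallyIntegrable_H _).locallyIntegrableOn _,
    (locallyIntegrable_H _).locallyIntegrableOn _, fun φ h1 h2 _ => ?_⟩
  have h3 := (hasWeakDerivOn_V v).2.2 (fun x => φ (x - h)) (h1.comp (contDiff_id.sub contDiff_const))
    (h2.comp_homeomorph (Homeomorph.subRight h)) (subset_univ _)
  simp only [deriv_comp_sub_const, Measure.restrict_univ] at h3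
  change ∫ x in univ, deriv φ x • shift h (toH v) x = -∫ x in univ, φ x • shift h (dx v) x
  rw [Measure.restrict_univ, integral_mul_shift, integral_mul_shift]
  exact h3

/-- Translation by `h` on `H¹(ℝ)`. -/
def shiftV (h : ℝ) : V →L[ℝ] V :=
  LinearMap.mkContinuous
    { toFun := fun v => ⟨WithLp.toLp 2 (shift h (toH v), shift h (dx v)), shift_mem_H1 h v⟩
      map_add' := fun v w => by
        ext1
        simp only [map_add]
        rfl
      map_smul' := fun c v => by
        ext1
        simp only [map_smul]
        rfl } 1 fun v => by
    rw [one_mul]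
    refine le_of_sq_le_sq (le_of_eq ?_) (norm_nonneg _)
    rw [norm_sq_V v, ← (shift h).norm_map (toH v), ← (shift h).norm_map (dx v)]
    exact WithLp.prod_norm_sq_eq_of_L2 _

theorem toH_shiftV (h : ℝ) (v : V) : toH (shiftV h v) = shift h (toH v) := rfl

theorem dx_shiftV (h : ℝ) (v : V) : dx (shiftV h v) = shift h (dx v) := rfl

/-- The difference quotient with step `h` on `L²(ℝ)`. -/
def diffQuot (h : ℝ) : H →L[ℝ] H := h⁻¹ • ((shift h).toContinuousLinearMap - .id ℝ H)

/-- The difference quotient with step `h` on `H¹(ℝ)`. -/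
def diffQuotV (h : ℝ) : V →L[ℝ] V := h⁻¹ • (shiftV h - .id ℝ V)

theorem diffQuot_apply (h : ℝ) (f : H) : diffQuot h f = h⁻¹ • (shift h f - f) := rfl

theorem toH_diffQuotV (h : ℝ) (v : V) : toH (diffQuotV h v) = diffQuot h (toH v) := by
  simp [diffQuotV, diffQuot_apply, toH_shiftV]

theorem dx_diffQuotV (h : ℝ) (v : V) : dx (diffQuotV h v) = diffQuot h (dx v) := by
  simp [diffQuotV, diffQuot_apply, dx_shiftV]

/-- Discrete integration by parts: $D_h^*=-D_{-h}$, because the adjoint of a translation is its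
inverse. -/
theorem inner_diffQuot (h : ℝ) (f g : H) :
    inner ℝ (diffQuot h f) g = -inner ℝ f (diffQuot (-h) g) := by
  simp only [diffQuot_apply, inner_smul_left, inner_smul_right, inner_sub_left, inner_sub_right,
    inner_shift]
  simp

/-- The operator `D_h^* D_h` on `H¹(ℝ)`, with `D_h` the difference quotient. -/
def secondDiffQuotV (h : ℝ) : V →L[ℝ] V := -(diffQuotV (-h)).comp (diffQuotV h)

theorem toH_secondDiffQuotV (h : ℝ) (v : V) :
    toH (secondDiffQuotV h v) = -diffQuot (-h) (diffQuot h (toH v)) := by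
  simp [secondDiffQuotV, toH_diffQuotV]

theorem dx_secondDiffQuotV (h : ℝ) (v : V) :
    dx (secondDiffQuotV h v) = -diffQuot (-h) (diffQuot h (dx v)) := by
  simp [secondDiffQuotV, dx_diffQuotV]

theorem inner_diffQuot_diffQuot (h : ℝ) (f : H) (v : V) :
    inner ℝ (diffQuot h f) (diffQuot h (toH v)) = inner ℝ f (toH (secondDiffQuotV h v)) := by
  rw [inner_diffQuot, toH_secondDiffQuotV, inner_neg_right]

/-- The viscous term tested with $D_h^*D_hv$ becomes $\|D_h\partial_xv\|_H^2$, the discrete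
substitute for $\|\partial_{xx}v\|_H^2$. -/
theorem inner_dx_secondDiffQuotV (h : ℝ) (v : V) :
    inner ℝ (dx v) (dx (secondDiffQuotV h v)) = ‖diffQuot h (dx v)‖ ^ 2 := by
  rw [dx_secondDiffQuotV, inner_neg_right, ← inner_diffQuot, real_inner_self_eq_norm_sq]

theorem sq_intervalIntegral_le {g : ℝ → ℝ} {a b : ℝ} (hab : a ≤ b)
    (hg : IntegrableOn (fun x => g x ^ 2) (Ioc a b)) (hm : AEStronglyMeasurable g) :
    (∫ x in a..b, g x) ^ 2 ≤ (b - a) * ∫ x in a..b, g x ^ 2 := by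
  have hL : MemLp g 2 (volume.restrict (Ioc a b)) := (memLp_two_iff_integrable_sq hm.restrict).2 hg
  have hi : Integrable g (volume.restrict (Ioc a b)) := hL.integrable one_le_two
  rcases hab.eq_or_lt with rfl | hlt
  · simp
  -- With $c$ the mean of $g$, nonnegativity of the variance is the Cauchy–Schwarz bound sought.
  set c := (∫ x in a..b, g x) / (b - a)
  have h0 : 0 ≤ ∫ x in a..b, (g x - c) ^ 2 :=
    intervalIntegral.integral_nonneg hab fun x _ => sq_nonneg _
  have hi' : IntervalIntegrable g volume a b := (intervalIntegrable_iff_integrableOn_Ioc_of_le hab).2 hi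
  have hg' : IntervalIntegrable (fun x => g x ^ 2) volume a b :=
    (intervalIntegrable_iff_integrableOn_Ioc_of_le hab).2 hg
  have e : ∫ x in a..b, (g x - c) ^ 2
      = (∫ x in a..b, g x ^ 2) - 2 * c * (∫ x in a..b, g x) + (b - a) * c ^ 2 := by
    have : ∀ x, (g x - c) ^ 2 = g x ^ 2 - 2 * c * g x + c ^ 2 := fun x => by ring
    simp_rw [this]
    rw [intervalIntegral.integral_add (hg'.sub (hi'.const_mul _)) intervalIntegrable_const,
      intervalIntegral.integral_sub hg' (hi'.const_mul _), intervalIntegral.integral_const_mul,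
      intervalIntegral.integral_const, smul_eq_mul]
  have hne : b - a ≠ 0 := by linarith
  have hc : ∫ x in a..b, g x = c * (b - a) := (div_mul_cancel₀ _ hne).symm
  rw [e, hc] at h0
  rw [hc]
  have : 0 < b - a := by linarith
  nlinarith

/-- $D_hv(x)$ is the mean of $\partial_xv$ over $[x,x+h]$. Cauchy–Schwarz on this mean, then Tonelli
and translation invariance, give the bound with constant 1. -/
theorem norm_diffQuot_le_of_pos {h : ℝ} (hh : 0 < h) (v : V) : ‖diffQuot h (toH v)‖ ≤ ‖dx v‖ := by
  obtain ⟨w, hvw, hw⟩ := exists_representative v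
  refine le_of_sq_le_sq ?_ (norm_nonneg _)
  have hw' := (measurePreserving_add_right volume h).quasiMeasurePreserving.ae hvw
  have hpt : ∀ᵐ x, ENNReal.ofReal (diffQuot h (toH v) x ^ 2)
      ≤ ENNReal.ofReal h⁻¹ * ∫⁻ s in Ioc 0 h, ENNReal.ofReal (dx v (x + s) ^ 2) := by
    rw [diffQuot_apply]
    filter_upwards [Lp.coeFn_smul h⁻¹ (shift h (toH v) - toH v),
      Lp.coeFn_sub (shift h (toH v)) (toH v), shift_ae h (toH v), hvw, hw'] with x h1 h2 h3 h4 h5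
    have hint : Integrable (fun s => dx v (x + s) ^ 2) := (integrable_sq_H (dx v)).comp_add_left x
    rw [h1, Pi.smul_apply, h2, Pi.sub_apply, h3, h4, h5, hw, smul_eq_mul,
      ← ofReal_integral_eq_lintegral_ofReal hint.integrableOn (.of_forall fun s => sq_nonneg _),
      ← ENNReal.ofReal_mul (by positivity)]
    apply ENNReal.ofReal_le_ofReal
    have h6 := sq_intervalIntegral_le (g := fun s => dx v (x + s)) hh.le hint.integrableOn
      ((Lp.aestronglyMeasurable (dx v)).comp_quasiMeasurePreserving
        (measurePreserving_add_left volume x).quasiMeasurePreserving)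
    rw [intervalIntegral.integral_comp_add_left (fun s => dx v s) x, add_zero,
      intervalIntegral.integral_of_le hh.le, sub_zero] at h6
    calc (h⁻¹ * ∫ s in x..x + h, dx v s) ^ 2 = h⁻¹ ^ 2 * (∫ s in x..x + h, dx v s) ^ 2 := by ring
      _ ≤ h⁻¹ ^ 2 * (h * ∫ s in Ioc 0 h, dx v (x + s) ^ 2) := by gcongr
      _ = h⁻¹ * ∫ s in Ioc 0 h, dx v (x + s) ^ 2 := by field_simp
  have hm : AEMeasurable (fun p : ℝ × ℝ => ENNReal.ofReal (dx v (p.1 + p.2) ^ 2))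
      (volume.prod (volume.restrict (Ioc 0 h))) := by
    refine ENNReal.measurable_ofReal.comp_aemeasurable (AEMeasurable.pow_const ?_ 2)
    exact ((Lp.stronglyMeasurable (dx v)).measurable.comp
      (measurable_fst.add measurable_snd)).aemeasurable
  have key : ENNReal.ofReal (‖diffQuot h (toH v)‖ ^ 2) ≤ ENNReal.ofReal (‖dx v‖ ^ 2) := by
    rw [norm_sq_eq_lintegral]
    calc ∫⁻ x, ENNReal.ofReal (diffQuot h (toH v) x ^ 2)
        ≤ ∫⁻ x, ENNReal.ofReal h⁻¹ * ∫⁻ s in Ioc 0 h, ENNReal.ofReal (dx v (x + s) ^ 2) :=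
          lintegral_mono_ae hpt
      _ = ENNReal.ofReal h⁻¹ * ∫⁻ s in Ioc 0 h, ∫⁻ x, ENNReal.ofReal (dx v (x + s) ^ 2) := by
          rw [lintegral_const_mul' _ _ ENNReal.ofReal_ne_top, lintegral_lintegral_swap hm]
      _ = ENNReal.ofReal h⁻¹ * ∫⁻ s in Ioc 0 h, ENNReal.ofReal (‖dx v‖ ^ 2) := by
          congr 2 with s
          rw [norm_sq_eq_lintegral,
            lintegral_add_right_eq_self (fun x => ENNReal.ofReal (dx v x ^ 2)) s]
      _ = ENNReal.ofReal (‖dx v‖ ^ 2) := by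
          rw [lintegral_const, Measure.restrict_apply_univ, Real.volume_Ioc, sub_zero,
            ← ENNReal.ofReal_mul (by positivity), ← ENNReal.ofReal_mul (by positivity)]
          congr 1
          field_simp
  exact (ENNReal.ofReal_le_ofReal_iff (sq_nonneg _)).1 key

theorem norm_diffQuot_neg (h : ℝ) (f : H) : ‖diffQuot (-h) f‖ = ‖diffQuot h f‖ := by
  have : diffQuot h f = shift h (diffQuot (-h) f) := by
    rw [diffQuot_apply, diffQuot_apply, map_smul, map_sub, shift_shift_neg, inv_neg, neg_smul,
      ← smul_neg, neg_sub]
  rw [this, LinearIsometry.norm_map]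

theorem norm_diffQuot_le {h : ℝ} (hh : h ≠ 0) (v : V) : ‖diffQuot h (toH v)‖ ≤ ‖dx v‖ := by
  rcases lt_or_gt_of_ne hh with h0 | h0
  · rw [← norm_diffQuot_neg]
    exact norm_diffQuot_le_of_pos (by linarith) v
  · exact norm_diffQuot_le_of_pos h0 v

/-- The difference quotient bound applied to $D_hv\in V$. It lets pairings with the test function
$D_h^*D_hv$ be absorbed by the viscous term. -/
theorem norm_toH_secondDiffQuotV_le {h : ℝ} (hh : h ≠ 0) (v : V) :
    ‖toH (secondDiffQuotV h v)‖ ≤ ‖diffQuot h (dx v)‖ := by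
  rw [toH_secondDiffQuotV, norm_neg, ← toH_diffQuotV, ← dx_diffQuotV]
  exact norm_diffQuot_le (neg_ne_zero.2 hh) _

/-- The quotients of the absolutely continuous representative converge a.e. to $\partial_xv$, so
Fatou's lemma passes the uniform bound to the limit. -/
theorem norm_dx_sq_le_of_diffQuot {v : V} {K : ℝ}
    (hK : ∀ n : ℕ, ‖diffQuot (1 / ((n : ℝ) + 1)) (toH v)‖ ^ 2 ≤ K) : ‖dx v‖ ^ 2 ≤ K := by
  obtain ⟨w, hvw, hw⟩ := exists_representative v
  have hK0 : 0 ≤ K := (sq_nonneg _).trans (hK 0)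
  rw [← ENNReal.ofReal_le_ofReal_iff hK0, norm_sq_eq_lintegral]
  have hpt : ∀ᵐ x, ∀ n : ℕ, diffQuot (1 / ((n : ℝ) + 1)) (toH v) x
      = (1 / ((n : ℝ) + 1))⁻¹ * (w (x + 1 / ((n : ℝ) + 1)) - w x) := by
    rw [ae_all_iff]
    intro n
    set h := 1 / ((n : ℝ) + 1)
    have hw' := (measurePreserving_add_right volume h).quasiMeasurePreserving.ae hvw
    rw [diffQuot_apply]
    filter_upwards [Lp.coeFn_smul h⁻¹ (shift h (toH v) - toH v),
      Lp.coeFn_sub (shift h (toH v)) (toH v), shift_ae h (toH v), hvw, hw'] with x h1 h2 h3 h4 h5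
    rw [h1, Pi.smul_apply, h2, Pi.sub_apply, h3, h4, h5, smul_eq_mul]
  have hlim : ∀ᵐ x, Tendsto (fun n : ℕ => ENNReal.ofReal
      (diffQuot (1 / ((n : ℝ) + 1)) (toH v) x ^ 2)) atTop (𝓝 (ENNReal.ofReal (dx v x ^ 2))) := by
    filter_upwards [hpt, representative_ae_hasDerivAt hw (locallyIntegrable_H (dx v))] with x h1 h2
    refine (ENNReal.continuous_ofReal.tendsto _).comp (Tendsto.pow ?_ 2)
    have h3 : Tendsto (fun n : ℕ => 1 / ((n : ℝ) + 1)) atTop (𝓝[≠] 0) :=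
      tendsto_nhdsWithin_iff.2 ⟨tendsto_one_div_add_atTop_nhds_zero_nat,
        .of_forall fun n => by simp only [mem_compl_iff, mem_singleton_iff]; positivity⟩
    refine ((hasDerivAt_iff_tendsto_slope_zero.1 h2).comp h3).congr fun n => ?_
    rw [h1 n]
    rfl
  calc ∫⁻ x, ENNReal.ofReal (dx v x ^ 2)
      = ∫⁻ x, liminf (fun n : ℕ => ENNReal.ofReal
          (diffQuot (1 / ((n : ℝ) + 1)) (toH v) x ^ 2)) atTop :=
        lintegral_congr_ae (hlim.mono fun x hx => hx.liminf_eq.symm)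
    _ ≤ liminf (fun n : ℕ => ∫⁻ x, ENNReal.ofReal
          (diffQuot (1 / ((n : ℝ) + 1)) (toH v) x ^ 2)) atTop :=
        lintegral_liminf_le fun n => ENNReal.measurable_ofReal.comp
          ((Lp.stronglyMeasurable _).measurable.pow_const 2)
    _ ≤ liminf (fun _ : ℕ => ENNReal.ofReal K) atTop := by
        refine liminf_le_liminf (.of_forall fun n => ?_)
        rw [← norm_sq_eq_lintegral]
        exact ENNReal.ofReal_le_ofReal (hK n)
    _ = ENNReal.ofReal K := liminf_const _

end Translation

/-! ### The energy identity and the pointwise equation -/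

instance : NormedAddCommGroup VDual := ContinuousLinearMap.toNormedAddCommGroup

instance : NormedSpace ℝ VDual := ContinuousLinearMap.toNormedSpace

instance : CompleteSpace VDual := ContinuousLinearMap.instCompleteSpace

section Energy

theorem le_on_Icc_of_ae_le {T : ℝ} (hT : 0 < T) {f g : ℝ → ℝ} (hf : ContinuousOn f (Icc 0 T))
    (hg : ContinuousOn g (Icc 0 T)) (h : ∀ᵐ t, t ∈ Ioo 0 T → f t ≤ g t) :
    ∀ t ∈ Icc 0 T, f t ≤ g t := by
  have h' : (fun t => max (f t) (g t)) =ᵐ[volume.restrict (Icc 0 T)] g := by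
    rw [← restrict_Ioo_eq_restrict_Icc, EventuallyEq, ae_restrict_iff' measurableSet_Ioo]
    filter_upwards [h] with t ht ht'
    exact max_eq_right (ht ht')
  intro t ht
  have := Measure.eqOn_Icc_of_ae_eq volume hT.ne h' (hf.sup hg) hg ht
  exact max_eq_right_iff.1 this

theorem norm_toDual_le (v : V) : ‖toDual v‖ ≤ ‖v‖ := by
  refine ContinuousLinearMap.opNorm_le_bound _ (norm_nonneg _) fun φ => ?_
  exact (norm_inner_le_norm (𝕜 := ℝ) (toH v) (toH φ)).trans
    (mul_le_mul (norm_toH_le v) (norm_toH_le φ) (norm_nonneg _) (norm_nonneg _))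

theorem ae_norm_le_normLp {E : Type*} [NormedAddCommGroup E] {T : ℝ} {y : ℝ → E}
    (hy : MemLp y ⊤ (timeMeasure T)) : ∀ᵐ t ∂timeMeasure T, ‖y t‖ ≤ normLp ⊤ T y := by
  filter_upwards [ae_le_eLpNormEssSup (f := y) (μ := timeMeasure T)] with t ht
  have := (ENNReal.toReal_le_toReal (by simp) hy.eLpNorm_ne_top).2
    (ht.trans_eq eLpNorm_exponent_top.symm)
  simpa [normLp] using this

variable {T : ℝ} {y : ℝ → V} {dy : ℝ → VDual}

theorem MemW.integrableOn_toDual (hW : MemW T y dy) :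
    IntegrableOn (fun t => toDual (y t)) (Ioo 0 T) := by
  have h : MemLp (fun t => toDual (y t)) 2 (timeMeasure T) :=
    MemLp.of_le hW.memLp hW.hasWeakDeriv.1.aestronglyMeasurable
      (.of_forall fun t => norm_toDual_le _)
  exact h.integrable one_le_two

theorem MemW.integrableOn_deriv (hW : MemW T y dy) : IntegrableOn dy (Ioo 0 T) :=
  hW.memLp_deriv.integrable one_le_two

/-- The chain rule for `t ↦ ‖D y(t)‖²`, where `D^* D` restricts to the operator `B` on `V`. -/
theorem energy_identity (hT : 0 < T) (hW : MemW T y dy) (hy : MemLp y ⊤ (timeMeasure T))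
    {z : ℝ → H} (hz : ContinuousOn z (Icc 0 T)) (hyz : ∀ᵐ t ∂timeMeasure T, toH (y t) = z t)
    (D : H →L[ℝ] H) (B : V →L[ℝ] V)
    (hDB : ∀ (f : H) (v : V), inner ℝ (D f) (D (toH v)) = inner ℝ f (toH (B v))) :
    ∀ t ∈ Icc 0 T, ‖D (z t)‖ ^ 2 - ‖D (z 0)‖ ^ 2 = ∫ s in (0 : ℝ)..t, 2 * dy s (B (y s)) := by
  have h0 : (0 : ℝ) ∈ Icc 0 T := ⟨le_rfl, hT.le⟩
  set M := normLp ⊤ T y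
  have hM := ae_norm_le_normLp hy
  have hdi := hW.integrableOn_deriv
  obtain ⟨G, hG, hGd⟩ := exists_ae_sub_eq_integral isOpen_Ioo ordConnected_Ioo
    (((integrable_indicator_iff measurableSet_Ioo).2 hW.integrableOn_toDual).locallyIntegrable)
    (((integrable_indicator_iff measurableSet_Ioo).2 hdi).locallyIntegrable) hW.hasWeakDeriv
  rw [ae_restrict_iff' measurableSet_Ioo] at hM hyz
  set E : ℝ → ℝ := fun t => ‖D (z t)‖ ^ 2
  have hE : ContinuousOn E (Icc 0 T) := (D.continuous.comp_continuousOn hz).norm.pow 2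
  -- The times at which every almost-everywhere statement holds at once; estimates proved on it
  -- extend to $[0,T]$ by continuity.
  set S : Set ℝ := {t | t ∈ Ioo 0 T ∧ t ∈ G ∧ toH (y t) = z t ∧ ‖y t‖ ≤ M}
  have hS : ∀ᵐ t, t ∈ Ioo 0 T → t ∈ S := by
    filter_upwards [hG, hM, hyz] with t h1 h2 h3 h4
    exact ⟨h4, h1, h3 h4, h2 h4⟩
  have hSI : ∀ t ∈ S, t ∈ Icc 0 T := fun t ht => Ioo_subset_Icc_self ht.1
  have hint : ∀ {s t}, s ∈ Icc 0 T → t ∈ Icc 0 T → IntervalIntegrable dy volume s t :=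
    fun hs ht => intervalIntegrable_of_integrableOn_Ioo hdi hs ht
  have hFc : ∀ t ∈ Icc 0 T, ContinuousOn (fun s => ∫ x in t..s, dy x) (Icc 0 T) := by
    intro t ht
    have := intervalIntegral.continuousOn_primitive_interval' (hint h0 ⟨hT.le, le_rfl⟩)
      (by rwa [uIcc_of_le hT.le])
    rwa [uIcc_of_le hT.le] at this
  -- The tangent inequality of the convex function $f\mapsto\|Df\|^2$ at $z(t)$; the discarded gap
  -- is $\|D(z(s)-z(t))\|^2$.
  have convex_ineq : ∀ t ∈ S, ∀ s ∈ S, 2 * (∫ x in t..s, dy x) (B (y t)) ≤ E s - E t := by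
    intro t ht s hs
    rw [← hGd t ⟨ht.2.1, ht.1⟩ s ⟨hs.2.1, hs.1⟩]
    have e : (toDual (y s) - toDual (y t)) (B (y t)) = inner ℝ (D (z s) - D (z t)) (D (z t)) := by
      rw [← map_sub, ← ht.2.2.1, ← hs.2.2.1, hDB, inner_sub_left]
      rfl
    rw [e]
    have h1 := norm_sub_sq_real (D (z s)) (D (z t))
    have h2 := sq_nonneg ‖D (z s) - D (z t)‖
    rw [inner_sub_left, real_inner_self_eq_norm_sq]
    simp only [E]
    linarith
  have convex_ineq' : ∀ t ∈ S, ∀ s ∈ Icc 0 T,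
      2 * (∫ x in t..s, dy x) (B (y t)) ≤ E s - E t := by
    intro t ht
    refine le_on_Icc_of_ae_le hT ?_ (hE.sub continuousOn_const)
      (hS.mono fun s hs hs' => convex_ineq t ht s (hs hs'))
    exact continuousOn_const.mul ((hFc t (hSI t ht)).clm_apply continuousOn_const)
  set N : ℝ → ℝ := fun t => ∫ x in (0 : ℝ)..t, ‖dy x‖
  have hNac : AbsolutelyContinuousOnInterval N 0 T :=
    (hint h0 ⟨hT.le, le_rfl⟩).norm.absolutelyContinuousOnInterval_intervalIntegral left_mem_uIcc
  have hNc : ContinuousOn N (Icc 0 T) := by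
    have := hNac.continuousOn
    rwa [uIcc_of_le hT.le] at this
  set K := 2 * (‖B‖ * M)
  -- Bounding the tangent term by $\|y(t)\|_V\le M$ gives a one-sided estimate. Exchanging $s$ and
  -- $t$ makes it two-sided, so $E$ is as absolutely continuous as $N$.
  have lower : ∀ t ∈ S, ∀ s ∈ S, -(K * |N s - N t|) ≤ E s - E t := by
    intro t ht s hs
    refine le_trans ?_ (convex_ineq t ht s hs)
    have h1 : ‖(∫ x in t..s, dy x) (B (y t))‖ ≤ |N s - N t| * (‖B‖ * M) := by
      refine (ContinuousLinearMap.le_opNorm _ _).trans ?_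
      have : N s - N t = ∫ x in t..s, ‖dy x‖ :=
        intervalIntegral.integral_interval_sub_left (hint h0 (hSI s hs)).norm
          (hint h0 (hSI t ht)).norm
      rw [this]
      gcongr
      · exact intervalIntegral.norm_integral_le_abs_integral_norm
      · exact (B.le_opNorm _).trans (by gcongr; exact ht.2.2.2)
    have h2 := neg_abs_le ((∫ x in t..s, dy x) (B (y t)))
    rw [Real.norm_eq_abs] at h1
    simp only [K]
    linarith
  have lip : ∀ t ∈ S, ∀ s ∈ S, |E s - E t| ≤ K * |N s - N t| := by
    intro t ht s hs
    have h1 := lower t ht s hs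
    have h2 := lower s hs t ht
    rw [abs_sub_comm] at h2
    rw [abs_le]
    constructor <;> linarith
  have lip' : ∀ t ∈ S, ∀ s ∈ Icc 0 T, |E s - E t| ≤ K * |N s - N t| := fun t ht =>
    le_on_Icc_of_ae_le hT (hE.sub continuousOn_const).abs
      (continuousOn_const.mul (hNc.sub continuousOn_const).abs)
      (hS.mono fun s hs hs' => lip t ht s (hs hs'))
  have lip'' : ∀ s ∈ Icc 0 T, ∀ t ∈ Icc 0 T, |E s - E t| ≤ K * |N s - N t| := fun s hs =>
    le_on_Icc_of_ae_le hT (continuousOn_const.sub hE).abs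
      (continuousOn_const.mul (continuousOn_const.sub hNc).abs)
      (hS.mono fun t ht ht' => lip' t (ht ht') s hs)
  have hEac : AbsolutelyContinuousOnInterval E 0 T :=
    absolutelyContinuousOnInterval_of_dist_le (K := K) hNac fun s hs t ht => by
      rw [uIcc_of_le hT.le] at hs ht
      exact lip'' s hs t ht
  have hne0 : ∀ᵐ x : ℝ, x ≠ 0 := by simp [ae_iff, measure_singleton]
  have hneT : ∀ᵐ x : ℝ, x ≠ T := by simp [ae_iff, measure_singleton]
  have hder : ∀ᵐ x, x ∈ uIcc 0 T → HasDerivAt E (2 * dy x (B (y x))) x := by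
    filter_upwards [hEac.ae_differentiableAt, hS,
      (hint h0 ⟨hT.le, le_rfl⟩).ae_hasDerivAt_integral, hne0, hneT] with x h1 h2 h3 h4 h5 hx
    have hd := (h1 hx).hasDerivAt
    have hF := h3 hx x hx
    rw [uIcc_of_le hT.le] at hx
    have hxI : x ∈ Ioo 0 T := ⟨lt_of_le_of_ne hx.1 h4.symm, lt_of_le_of_ne hx.2 h5⟩
    -- The tangent inequality at $x$ says that $E$ minus its tangent term is minimal at $s=x$; where
    -- both are differentiable, their derivatives agree.
    have hmin : IsLocalMin (fun s => E s - 2 * (∫ r in x..s, dy r) (B (y x))) x := by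
      filter_upwards [Icc_mem_nhds hxI.1 hxI.2] with s hs
      have := convex_ineq' x (h2 hxI) s hs
      simp only [intervalIntegral.integral_same, zero_apply]
      linarith
    have hF' : HasDerivAt (fun s => (∫ r in x..s, dy r) (B (y x))) (dy x (B (y x))) x :=
      ((ContinuousLinearMap.apply ℝ ℝ (B (y x))).hasFDerivAt).comp_hasDerivAt x hF
    have := hmin.hasDerivAt_eq_zero (hd.sub (hF'.const_mul 2))
    rwa [sub_eq_zero.1 this] at hd
  intro t ht
  have hsub : uIcc 0 t ⊆ uIcc 0 T := by
    rw [uIcc_of_le hT.le, uIcc_of_le ht.1]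
    exact Icc_subset_Icc_right ht.2
  exact (integral_eq_sub_of_ae_hasDerivAt (hEac.mono hsub)
    (hder.mono fun x hx hx' => hx (hsub hx'))).symm

end Energy

section Equation

theorem integrableOn_smul_of_tsupport_subset {F : Type*} [NormedAddCommGroup F] [NormedSpace ℝ F]
    {Ω : Set ℝ} {f : ℝ → F} (hf : LocallyIntegrableOn f Ω) {a : ℝ → ℝ} (ha : Continuous a)
    (hc : HasCompactSupport a) (hs : tsupport a ⊆ Ω) : IntegrableOn (fun x => a x • f x) Ω := by
  have h : IntegrableOn (fun x => a x • f x) (tsupport a) :=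
    (hf.integrableOn_compact_subset hs hc).continuousOn_smul ha.continuousOn hc
  exact (h.integrable_of_forall_notMem_eq_zero fun x hx => by
    rw [image_eq_zero_of_notMem_tsupport hx, zero_smul]).integrableOn

theorem HasWeakDerivOn.ae_eq {F : Type*} [NormedAddCommGroup F] [NormedSpace ℝ F] [CompleteSpace F]
    {Ω : Set ℝ} (hΩ : IsOpen Ω) {f g₁ g₂ : ℝ → F}
    (h₁ : HasWeakDerivOn Ω f g₁) (h₂ : HasWeakDerivOn Ω f g₂) :
    ∀ᵐ t ∂volume.restrict Ω, g₁ t = g₂ t := by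
  rw [ae_restrict_iff' hΩ.measurableSet]
  have := hΩ.ae_eq_zero_of_integral_contDiff_smul_eq_zero (μ := volume) (h₁.2.1.sub h₂.2.1)
    fun a ha hc hs => by
      rw [← setIntegral_eq_integral_of_forall_compl_eq_zero (s := Ω) fun x hx => by
        rw [image_eq_zero_of_notMem_tsupport fun h => hx (hs h), zero_smul]]
      simp only [Pi.sub_apply, smul_sub]
      rw [integral_sub (integrableOn_smul_of_tsupport_subset h₁.2.1 ha.continuous hc hs)
        (integrableOn_smul_of_tsupport_subset h₂.2.1 ha.continuous hc hs),
        ← neg_inj, neg_sub', ← h₁.2.2 a ha hc hs, ← h₂.2.2 a ha hc hs]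
      simp
  filter_upwards [this] with t ht ht'
  exact sub_eq_zero.1 (ht ht')

variable {ν T : ℝ} {χ u : ℝ → ℝ} {y₀ : V} {y : ℝ → V} {dy : ℝ → VDual}

theorem MemW.hasWeakDerivOn_apply (hW : MemW T y dy) (φ : V) :
    HasWeakDerivOn (Ioo 0 T) (fun t => inner ℝ (toH (y t)) (toH φ)) (fun t => dy t φ) := by
  obtain ⟨h1, h2, h3⟩ := hW.hasWeakDeriv
  refine ⟨?_, ?_, fun a ha hc hs => ?_⟩
  · exact IntegrableOn.locallyIntegrableOn
      (Integrable.apply_continuousLinearMap hW.integrableOn_toDual φ)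
  · exact IntegrableOn.locallyIntegrableOn
      (Integrable.apply_continuousLinearMap hW.integrableOn_deriv φ)
  · have h4 := congrArg (fun L : VDual => L φ) (h3 a ha hc hs)
    simp only [neg_apply] at h4
    rw [ContinuousLinearMap.integral_apply (integrableOn_smul_of_tsupport_subset h2
        ha.continuous hc hs), ContinuousLinearMap.integral_apply
        (integrableOn_smul_of_tsupport_subset h1 (ha.continuous_deriv (by simp)) hc.deriv
        (tsupport_deriv_subset.trans hs))] at h4
    exact h4

instance : SecondCountableTopology H :=
  have : Fact ((2 : ENNReal) ≠ ⊤) := ⟨by simp⟩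
  Lp.SecondCountableTopology

theorem exists_countable_dense_V : ∃ s : Set V, s.Countable ∧ Dense s := by
  have : SecondCountableTopology (WithLp 2 (H × H)) :=
    (WithLp.homeomorphProd 2 H H).secondCountableTopology
  have : SecondCountableTopology V := TopologicalSpace.Subtype.secondCountableTopology _
  exact TopologicalSpace.exists_countable_dense V

/-- The equation holds in `V*` at almost every time. -/
theorem IsWeakSolution.ae_equation (hsol : IsWeakSolution ν T χ u y₀ y) (hW : MemW T y dy)
    (hχ : MemLp χ 2 volume) : ∀ᵐ t ∂timeMeasure T, ∀ φ : V,
      dy t φ + inner ℝ (convection (y t)) (toH φ) + ν * inner ℝ (dx (y t)) (dx φ)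
        = u t * inner ℝ (hχ.toLp χ) (toH φ) := by
  obtain ⟨s, hs, hd⟩ := exists_countable_dense_V
  -- The exceptional null set depends on $\phi$. Restricting to a countable dense set of test
  -- functions gives a single null set, and continuity in $\phi$ covers the rest of $V$.
  have h : ∀ᵐ t ∂timeMeasure T, ∀ φ ∈ s,
      dy t φ + inner ℝ (convection (y t)) (toH φ) + ν * inner ℝ (dx (y t)) (dx φ)
        = u t * inner ℝ (hχ.toLp χ) (toH φ) := by
    rw [ae_ball_iff hs]
    intro φ _
    obtain ⟨w, hw, hwe⟩ := hsol.equation φ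
    filter_upwards [hwe, hw.ae_eq isOpen_Ioo (hW.hasWeakDerivOn_apply φ)] with t h1 h2
    rw [← h2, inner_convection, h1, inner_eq_integral, ← integral_const_mul]
    refine integral_congr_ae ?_
    filter_upwards [hχ.coeFn_toLp] with x hx
    rw [hx]
    ring
  filter_upwards [h] with t ht
  refine fun φ => congrFun (Continuous.ext_on hd ?_ ?_ ht) φ
  · fun_prop
  · fun_prop

theorem norm_le_of_equation {v : V} {L : VDual} {X : H} {c : ℝ} (hν : 0 ≤ ν)
    (h : ∀ φ : V, L φ + inner ℝ (convection v) (toH φ) + ν * inner ℝ (dx v) (dx φ)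
      = c * inner ℝ X (toH φ)) :
    ‖L‖ ≤ ‖toH v‖ * ‖dx v‖ + ν * ‖dx v‖ + ‖X‖ * |c| := by
  refine ContinuousLinearMap.opNorm_le_bound _ (by positivity) fun φ => ?_
  have e : L φ = c * inner ℝ X (toH φ) - inner ℝ (convection v) (toH φ)
      - ν * inner ℝ (dx v) (dx φ) := by linarith [h φ]
  have h1 : |c * inner ℝ X (toH φ)| ≤ |c| * (‖X‖ * ‖φ‖) := by
    rw [abs_mul]
    gcongr
    exact (abs_real_inner_le_norm _ _).trans (by gcongr; exact norm_toH_le φ)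
  have h2 := abs_inner_convection_le v φ
  have h3 : |ν * inner ℝ (dx v) (dx φ)| ≤ ν * (‖dx v‖ * ‖φ‖) := by
    rw [abs_mul, abs_of_nonneg hν]
    gcongr
    exact (abs_real_inner_le_norm _ _).trans (by gcongr; exact norm_dx_le φ)
  rw [e, Real.norm_eq_abs]
  have h4 := abs_sub (c * inner ℝ X (toH φ) - inner ℝ (convection v) (toH φ))
    (ν * inner ℝ (dx v) (dx φ))
  have h5 := abs_sub (c * inner ℝ X (toH φ)) (inner ℝ (convection v) (toH φ))
  linarith

end Equation

/-! ### A priori estimates -/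

section Estimates

theorem sq_normLp_two {E : Type*} [NormedAddCommGroup E] {T : ℝ} (hT : 0 ≤ T) {f : ℝ → E}
    (hf : MemLp f 2 (timeMeasure T)) : normLp 2 T f ^ 2 = ∫ t in (0 : ℝ)..T, ‖f t‖ ^ 2 := by
  rw [normLp, hf.eLpNorm_eq_integral_rpow_norm (by simp) (by simp),
    ENNReal.toReal_ofReal (by positivity), intervalIntegral.integral_of_le hT,
    integral_Ioc_eq_integral_Ioo]
  simp only [ENNReal.toReal_ofNat, Real.rpow_ofNat]
  rw [← Real.rpow_natCast, ← Real.rpow_mul (by positivity)]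
  norm_num

theorem normLp_top_le {E : Type*} [NormedAddCommGroup E] {T : ℝ} {f : ℝ → E} {c : ℝ} (hc : 0 ≤ c)
    (h : ∀ᵐ t ∂timeMeasure T, ‖f t‖ ≤ c) : normLp ⊤ T f ≤ c := by
  refine ENNReal.toReal_le_of_le_ofReal hc ?_
  rw [eLpNorm_exponent_top]
  exact eLpNormEssSup_le_of_ae_bound h

theorem integrableOn_norm_sq {E : Type*} [NormedAddCommGroup E] {T : ℝ} {f : ℝ → E}
    (hf : MemLp f 2 (timeMeasure T)) : IntegrableOn (fun t => ‖f t‖ ^ 2) (Ioo 0 T) :=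
  (memLp_two_iff_integrable_sq_norm hf.1).1 hf

theorem intervalIntegral_mono_of_integrableOn {T : ℝ} {f g : ℝ → ℝ}
    (hf : IntegrableOn f (Ioo 0 T)) (hg : IntegrableOn g (Ioo 0 T))
    (h : ∀ᵐ t ∂timeMeasure T, f t ≤ g t) {t : ℝ} (ht : t ∈ Icc 0 T) :
    ∫ s in (0 : ℝ)..t, f s ≤ ∫ s in (0 : ℝ)..t, g s := by
  rw [intervalIntegral.integral_of_le ht.1, intervalIntegral.integral_of_le ht.1,
    integral_Ioc_eq_integral_Ioo, integral_Ioc_eq_integral_Ioo]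
  have hsub : Ioo 0 t ⊆ Ioo 0 T := Ioo_subset_Ioo_right ht.2
  exact integral_mono_ae (hf.mono_set hsub) (hg.mono_set hsub) (ae_restrict_of_ae_restrict_of_subset hsub h)

theorem intervalIntegral_le_of_nonneg {T : ℝ} {f : ℝ → ℝ} (hf : IntegrableOn f (Ioo 0 T))
    (h : ∀ t, 0 ≤ f t) {t : ℝ} (ht : t ∈ Icc 0 T) :
    ∫ s in (0 : ℝ)..t, f s ≤ ∫ s in (0 : ℝ)..T, f s := by
  have h0 : (0 : ℝ) ∈ Icc 0 T := ⟨le_rfl, ht.1.trans ht.2⟩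
  have hT : T ∈ Icc 0 T := ⟨ht.1.trans ht.2, le_rfl⟩
  rw [← sub_nonneg, intervalIntegral.integral_interval_sub_left
    (intervalIntegrable_of_integrableOn_Ioo hf h0 hT)
    (intervalIntegrable_of_integrableOn_Ioo hf h0 ht)]
  exact intervalIntegral.integral_nonneg ht.2 fun s _ => h s

theorem integrableOn_norm_pow_mul {T : ℝ} {y : ℝ → V} (hy : MemLp y ⊤ (timeMeasure T)) (i j : ℕ) :
    IntegrableOn (fun t => ‖toH (y t)‖ ^ i * ‖dx (y t)‖ ^ j) (Ioo 0 T) := by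
  refine Integrable.of_bound (C := normLp ⊤ T y ^ i * normLp ⊤ T y ^ j) ?_ ?_
  · have hc : Continuous fun v : V => ‖toH v‖ ^ i * ‖dx v‖ ^ j := by fun_prop
    exact hc.comp_aestronglyMeasurable hy.1
  · filter_upwards [ae_norm_le_normLp hy] with t ht
    have h1 := (norm_toH_le (y t)).trans ht
    have h2 := (norm_dx_le (y t)).trans ht
    have h3 := (norm_nonneg (y t)).trans ht
    rw [Real.norm_of_nonneg (by positivity)]
    exact mul_le_mul (pow_le_pow_left₀ (norm_nonneg _) h1 i)
      (pow_le_pow_left₀ (norm_nonneg _) h2 j) (by positivity) (by positivity)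

variable {ν T : ℝ} {u : ℝ → ℝ} {y₀ : V} {y : ℝ → V} {dy : ℝ → VDual} {X : H} {z : ℝ → H}

theorem MemW.integrableOn_apply (hW : MemW T y dy) (hy : MemLp y ⊤ (timeMeasure T))
    (B : V →L[ℝ] V) : IntegrableOn (fun s => 2 * dy s (B (y s))) (Ioo 0 T) := by
  refine Integrable.const_mul ?_ 2
  refine Integrable.mono' (hW.integrableOn_deriv.norm.mul_const (‖B‖ * normLp ⊤ T y)) ?_ ?_
  · exact isBoundedBilinearMap_apply.continuous.comp_aestronglyMeasurable
      (hW.memLp_deriv.1.prodMk (B.continuous.comp_aestronglyMeasurable hy.1))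
  · filter_upwards [ae_norm_le_normLp hy] with t ht
    refine (ContinuousLinearMap.le_opNorm _ _).trans ?_
    gcongr
    exact (B.le_opNorm _).trans (by gcongr)

/-- Used with $D=B=\mathrm{id}$ for the $L^2$ estimate, and with $D=D_h$, $B=D_h^*D_h$ for the $H^1$
estimate. -/
theorem energy_le (hT : 0 < T) (hW : MemW T y dy) (hy : MemLp y ⊤ (timeMeasure T))
    (hz : ContinuousOn z (Icc 0 T)) (hyz : ∀ᵐ t ∂timeMeasure T, toH (y t) = z t)
    (D : H →L[ℝ] H) (B : V →L[ℝ] V)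
    (hDB : ∀ (f : H) (v : V), inner ℝ (D f) (D (toH v)) = inner ℝ f (toH (B v)))
    {g : ℝ → ℝ} (hg : IntegrableOn g (Ioo 0 T))
    (h : ∀ᵐ t ∂timeMeasure T, 2 * dy t (B (y t)) ≤ g t) {t : ℝ} (ht : t ∈ Icc 0 T) :
    ‖D (z t)‖ ^ 2 ≤ ‖D (z 0)‖ ^ 2 + ∫ s in (0 : ℝ)..t, g s := by
  have h1 := energy_identity hT hW hy hz hyz D B hDB t ht
  have h2 := intervalIntegral_mono_of_integrableOn (hW.integrableOn_apply hy B) hg h ht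
  linarith

theorem integral_sq_le_sq_normLp (hT : 0 < T) (hu : MemLp u 2 (timeMeasure T)) {t : ℝ}
    (ht : t ∈ Icc 0 T) : ∫ s in (0 : ℝ)..t, u s ^ 2 ≤ normLp 2 T u ^ 2 := by
  have h1 := integrableOn_norm_sq hu
  have h2 := intervalIntegral_le_of_nonneg h1 (fun t => sq_nonneg _) ht
  rw [← sq_normLp_two hT.le hu] at h2
  simpa using h2

/-- The equation is tested with $y$ itself: convection drops out, and $2ab\le a^2+b^2$ splits the
source term. The dissipation is kept, to bound $\int\|\partial_xy\|_H^2$ afterwards. -/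
theorem energy_estimate_L2_integral
    (hT : 0 < T) (hu : MemLp u 2 (timeMeasure T)) (hW : MemW T y dy)
    (hy : MemLp y ⊤ (timeMeasure T)) (hz : ContinuousOn z (Icc 0 T))
    (hyz : ∀ᵐ t ∂timeMeasure T, toH (y t) = z t) (hz0 : z 0 = toH y₀)
    (heq : ∀ᵐ t ∂timeMeasure T, ∀ φ : V,
      dy t φ + inner ℝ (convection (y t)) (toH φ) + ν * inner ℝ (dx (y t)) (dx φ)
        = u t * inner ℝ X (toH φ))
    {t : ℝ} (ht : t ∈ Icc 0 T) :
    ‖z t‖ ^ 2 + 2 * ν * ∫ s in (0 : ℝ)..t, ‖dx (y s)‖ ^ 2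
      ≤ ‖toH y₀‖ ^ 2 + ‖X‖ ^ 2 * normLp 2 T u ^ 2 + ∫ s in (0 : ℝ)..t, ‖toH (y s)‖ ^ 2 := by
  have hu2 : IntegrableOn (fun s => u s ^ 2) (Ioo 0 T) := by
    simpa using integrableOn_norm_sq hu
  have ha : IntegrableOn (fun s => ‖toH (y s)‖ ^ 2) (Ioo 0 T) := by
    simpa using integrableOn_norm_pow_mul hy 2 0
  have hb : IntegrableOn (fun s => ‖dx (y s)‖ ^ 2) (Ioo 0 T) := by
    simpa using integrableOn_norm_pow_mul hy 0 2
  have h0 : (0 : ℝ) ∈ Icc 0 T := ⟨le_rfl, hT.le⟩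
  have hu' : IntegrableOn (fun s => ‖X‖ ^ 2 * u s ^ 2) (Ioo 0 T) := hu2.const_mul _
  have hb' : IntegrableOn (fun s => 2 * ν * ‖dx (y s)‖ ^ 2) (Ioo 0 T) := hb.const_mul _
  have hua : IntegrableOn (fun s => ‖X‖ ^ 2 * u s ^ 2 + ‖toH (y s)‖ ^ 2) (Ioo 0 T) := hu'.add ha
  have h := energy_le hT hW hy hz hyz (.id ℝ H) (.id ℝ V) (fun _ _ => rfl)
    (g := fun s => ‖X‖ ^ 2 * u s ^ 2 + ‖toH (y s)‖ ^ 2 - 2 * ν * ‖dx (y s)‖ ^ 2)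
    (hua.sub hb') ?_ ht
  · have hi {f : ℝ → ℝ} (hf : IntegrableOn f (Ioo 0 T)) : IntervalIntegrable f volume 0 t :=
      intervalIntegrable_of_integrableOn_Ioo hf h0 ht
    rw [intervalIntegral.integral_sub (hi hua) (hi hb'),
      intervalIntegral.integral_add (hi hu') (hi ha),
      intervalIntegral.integral_const_mul, intervalIntegral.integral_const_mul] at h
    have h1 := mul_le_mul_of_nonneg_left (integral_sq_le_sq_normLp hT hu ht) (sq_nonneg ‖X‖)
    simp only [ContinuousLinearMap.id_apply, hz0] at h
    linarith
  · filter_upwards [heq] with s hs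
    have h1 := hs (y s)
    rw [inner_convection_self, real_inner_self_eq_norm_sq, add_zero] at h1
    have h2 : u s * inner ℝ X (toH (y s)) ≤ |u s| * (‖X‖ * ‖toH (y s)‖) :=
      (le_abs_self _).trans (by rw [abs_mul]; gcongr; exact abs_real_inner_le_norm _ _)
    have h3 := sq_nonneg (|u s| * ‖X‖ - ‖toH (y s)‖)
    have h4 := sq_abs (u s)
    simp only [ContinuousLinearMap.id_apply]
    nlinarith

theorem ae_sq_norm_toH_le (hν : 0 < ν)
    (hT : 0 < T) (hu : MemLp u 2 (timeMeasure T)) (hW : MemW T y dy)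
    (hy : MemLp y ⊤ (timeMeasure T)) (hz : ContinuousOn z (Icc 0 T))
    (hyz : ∀ᵐ t ∂timeMeasure T, toH (y t) = z t) (hz0 : z 0 = toH y₀)
    (heq : ∀ᵐ t ∂timeMeasure T, ∀ φ : V,
      dy t φ + inner ℝ (convection (y t)) (toH φ) + ν * inner ℝ (dx (y t)) (dx φ)
        = u t * inner ℝ X (toH φ)) :
    ∀ᵐ t ∂timeMeasure T, ‖toH (y t)‖ ^ 2
    ≤ (‖toH y₀‖ ^ 2 + ‖X‖ ^ 2 * normLp 2 T u ^ 2) * Real.exp T := by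
  have ha : IntegrableOn (fun s => ‖toH (y s)‖ ^ 2) (Ioo 0 T) := by
    simpa using integrableOn_norm_pow_mul hy 2 0
  have h := ae_le_mul_exp_of_ae_le_add_integral hT.le
    (A := ‖toH y₀‖ ^ 2 + ‖X‖ ^ 2 * normLp 2 T u ^ 2) (by positivity)
    (β := fun _ => 1) (f := fun t => ‖toH (y t)‖ ^ 2)
    (integrableOn_const (by simp)) (fun _ => zero_le_one) (by simpa using ha) ?_
  · simpa using h
  · filter_upwards [hyz, ae_restrict_mem measurableSet_Ioo] with t ht htI
    have h1 := energy_estimate_L2_integral hT hu hW hy hz hyz hz0 heq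
      (Ioo_subset_Icc_self htI)
    have h2 : 0 ≤ ∫ s in (0 : ℝ)..t, ‖dx (y s)‖ ^ 2 :=
      intervalIntegral.integral_nonneg htI.1.le fun s _ => sq_nonneg _
    rw [ht]
    simp only [one_mul]
    nlinarith

theorem integral_sq_norm_toH_le (hν : 0 < ν)
    (hT : 0 < T) (hu : MemLp u 2 (timeMeasure T)) (hW : MemW T y dy)
    (hy : MemLp y ⊤ (timeMeasure T)) (hz : ContinuousOn z (Icc 0 T))
    (hyz : ∀ᵐ t ∂timeMeasure T, toH (y t) = z t) (hz0 : z 0 = toH y₀)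
    (heq : ∀ᵐ t ∂timeMeasure T, ∀ φ : V,
      dy t φ + inner ℝ (convection (y t)) (toH φ) + ν * inner ℝ (dx (y t)) (dx φ)
        = u t * inner ℝ X (toH φ)) :
    ∫ s in (0 : ℝ)..T, ‖toH (y s)‖ ^ 2
    ≤ T * ((‖toH y₀‖ ^ 2 + ‖X‖ ^ 2 * normLp 2 T u ^ 2) * Real.exp T) := by
  have ha : IntegrableOn (fun s => ‖toH (y s)‖ ^ 2) (Ioo 0 T) := by
    simpa using integrableOn_norm_pow_mul hy 2 0
  have h := intervalIntegral_mono_of_integrableOn ha (integrableOn_const (by simp))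
    (ae_sq_norm_toH_le hν hT hu hW hy hz hyz hz0 heq) (right_mem_Icc.2 hT.le)
  refine h.trans (le_of_eq ?_)
  rw [intervalIntegral.integral_const, sub_zero, smul_eq_mul]

/-- The integrated energy estimate at $t=T$, with $\|z(T)\|^2$ discarded and the Gronwall bound
inserted on the right. -/
theorem integral_sq_norm_dx_le (hν : 0 < ν)
    (hT : 0 < T) (hu : MemLp u 2 (timeMeasure T)) (hW : MemW T y dy)
    (hy : MemLp y ⊤ (timeMeasure T)) (hz : ContinuousOn z (Icc 0 T))
    (hyz : ∀ᵐ t ∂timeMeasure T, toH (y t) = z t) (hz0 : z 0 = toH y₀)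
    (heq : ∀ᵐ t ∂timeMeasure T, ∀ φ : V,
      dy t φ + inner ℝ (convection (y t)) (toH φ) + ν * inner ℝ (dx (y t)) (dx φ)
        = u t * inner ℝ X (toH φ)) :
    ∫ s in (0 : ℝ)..T, ‖dx (y s)‖ ^ 2
    ≤ (‖toH y₀‖ ^ 2 + ‖X‖ ^ 2 * normLp 2 T u ^ 2) * ((1 + T * Real.exp T) / (2 * ν)) := by
  have h1 := energy_estimate_L2_integral hT hu hW hy hz hyz hz0 heq (right_mem_Icc.2 hT.le)
  have h2 := integral_sq_norm_toH_le hν hT hu hW hy hz hyz hz0 heq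
  rw [← mul_div_assoc, le_div_iff₀ (by positivity)]
  nlinarith [sq_nonneg ‖z T‖]

/-- The discrete form of testing with $-\partial_{xx}y$: all dissipation is spent on absorbing
source and convection, which leaves a right-hand side free of $h$. -/
theorem ae_sq_norm_dx_le_integral (hν : 0 < ν)
    (hT : 0 < T) (hu : MemLp u 2 (timeMeasure T)) (hW : MemW T y dy)
    (hy : MemLp y ⊤ (timeMeasure T)) (hz : ContinuousOn z (Icc 0 T))
    (hyz : ∀ᵐ t ∂timeMeasure T, toH (y t) = z t) (hz0 : z 0 = toH y₀)
    (heq : ∀ᵐ t ∂timeMeasure T, ∀ φ : V,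
      dy t φ + inner ℝ (convection (y t)) (toH φ) + ν * inner ℝ (dx (y t)) (dx φ)
        = u t * inner ℝ X (toH φ)) :
    ∀ᵐ t ∂timeMeasure T, ‖dx (y t)‖ ^ 2
    ≤ (‖dx y₀‖ ^ 2 + ‖X‖ ^ 2 * normLp 2 T u ^ 2 / ν)
      + ∫ s in (0 : ℝ)..t, 2 / ν * (‖toH (y s)‖ * ‖dx (y s)‖) * ‖dx (y s)‖ ^ 2 := by
  have h0 : (0 : ℝ) ∈ Icc 0 T := ⟨le_rfl, hT.le⟩
  have hu2 : IntegrableOn (fun s => u s ^ 2) (Ioo 0 T) := by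
    simpa using integrableOn_norm_sq hu
  have hab : IntegrableOn (fun s => 2 / ν * (‖toH (y s)‖ * ‖dx (y s)‖) * ‖dx (y s)‖ ^ 2)
      (Ioo 0 T) := by
    refine ((integrableOn_norm_pow_mul hy 1 3).const_mul (2 / ν)).congr (.of_forall fun s => ?_)
    simp only
    ring
  have hu' : IntegrableOn (fun s => ‖X‖ ^ 2 / ν * u s ^ 2) (Ioo 0 T) := hu2.const_mul _
  filter_upwards [hyz, ae_restrict_mem measurableSet_Ioo] with t ht htI
  have htI' := Ioo_subset_Icc_self htI
  -- The time $t$ is fixed before $n$: the energy inequality holds at every $t\in[0,T]$, so no null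
  -- set depends on the step size.
  refine norm_dx_sq_le_of_diffQuot fun n => ?_
  have hh : 1 / ((n : ℝ) + 1) ≠ 0 := by positivity
  set h := 1 / ((n : ℝ) + 1)
  have key := energy_le hT hW hy hz hyz (diffQuot h) (secondDiffQuotV h)
    (fun f v => inner_diffQuot_diffQuot h f v)
    (g := fun s => ‖X‖ ^ 2 / ν * u s ^ 2
      + 2 / ν * (‖toH (y s)‖ * ‖dx (y s)‖) * ‖dx (y s)‖ ^ 2)
    (hu'.add hab) ?_ htI'
  · have hi {f : ℝ → ℝ} (hf : IntegrableOn f (Ioo 0 T)) : IntervalIntegrable f volume 0 t :=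
      intervalIntegrable_of_integrableOn_Ioo hf h0 htI'
    rw [intervalIntegral.integral_add (hi hu') (hi hab),
      intervalIntegral.integral_const_mul, hz0, ← ht] at key
    have h1 := mul_le_mul_of_nonneg_left (integral_sq_le_sq_normLp hT hu htI')
      (by positivity : 0 ≤ ‖X‖ ^ 2 / ν)
    have h2 : ‖diffQuot h (toH y₀)‖ ^ 2 ≤ ‖dx y₀‖ ^ 2 := by
      gcongr
      exact norm_diffQuot_le hh y₀
    have h3 : ‖X‖ ^ 2 / ν * normLp 2 T u ^ 2 = ‖X‖ ^ 2 * normLp 2 T u ^ 2 / ν := by ring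
    linarith
  · filter_upwards [heq] with s hs
    have h1 := hs (secondDiffQuotV h (y s))
    rw [inner_dx_secondDiffQuotV] at h1
    set q := ‖diffQuot h (dx (y s))‖
    have hq := norm_toH_secondDiffQuotV_le hh (y s)
    set p := ‖convection (y s)‖
    have hp : p ^ 2 ≤ _ := norm_convection_sq_le (y s)
    have h2 : u s * inner ℝ X (toH (secondDiffQuotV h (y s))) ≤ |u s| * (‖X‖ * q) :=
      (le_abs_self _).trans (by
        rw [abs_mul]
        gcongr
        exact (abs_real_inner_le_norm _ _).trans (by gcongr))
    have h3 : -inner ℝ (convection (y s)) (toH (secondDiffQuotV h (y s))) ≤ p * q :=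
      (neg_le_abs _).trans ((abs_real_inner_le_norm _ _).trans (by gcongr))
    have h4 := sq_abs (u s)
    have h5 : 2 * dy s (secondDiffQuotV h (y s))
        ≤ 2 * (|u s| * ‖X‖ + p) * q - 2 * ν * q ^ 2 := by linarith
    -- With $m=|u|\|X\|+p$, maximising over $q$ gives $2mq-2\nu q^2\le m^2/(2\nu)$; then
    -- $m^2\le2(u^2\|X\|^2+p^2)$.
    have h6 : 2 * (|u s| * ‖X‖ + p) * q - 2 * ν * q ^ 2 ≤ (|u s| ^ 2 * ‖X‖ ^ 2 + p ^ 2) / ν := by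
      rw [le_div_iff₀ hν]
      nlinarith [sq_nonneg (2 * ν * q - (|u s| * ‖X‖ + p)), sq_nonneg (|u s| * ‖X‖ - p)]
    refine h5.trans (h6.trans ?_)
    rw [h4, add_div]
    refine add_le_add (le_of_eq (by ring)) ?_
    rw [div_le_iff₀ hν]
    refine hp.trans (le_of_eq ?_)
    field_simp

/-- Gronwall with weight
$\frac2\nu\|y\|_H\|\partial_xy\|_H\le\frac1\nu(\|y\|_H^2+\|\partial_xy\|_H^2)$, whose integral the
$L^2$ estimates control. The exponent hence involves no $\partial_xy_0$. -/
theorem ae_sq_norm_dx_le (hν : 0 < ν)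
    (hT : 0 < T) (hu : MemLp u 2 (timeMeasure T)) (hW : MemW T y dy)
    (hy : MemLp y ⊤ (timeMeasure T)) (hz : ContinuousOn z (Icc 0 T))
    (hyz : ∀ᵐ t ∂timeMeasure T, toH (y t) = z t) (hz0 : z 0 = toH y₀)
    (heq : ∀ᵐ t ∂timeMeasure T, ∀ φ : V,
      dy t φ + inner ℝ (convection (y t)) (toH φ) + ν * inner ℝ (dx (y t)) (dx φ)
        = u t * inner ℝ X (toH φ)) :
    ∀ᵐ t ∂timeMeasure T, ‖dx (y t)‖ ^ 2
    ≤ (‖dx y₀‖ ^ 2 + ‖X‖ ^ 2 * normLp 2 T u ^ 2 / ν)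
      * Real.exp ((T * Real.exp T + (1 + T * Real.exp T) / (2 * ν)) / ν
        * (‖toH y₀‖ ^ 2 + ‖X‖ ^ 2 * normLp 2 T u ^ 2)) := by
  have h0 : (0 : ℝ) ∈ Icc 0 T := ⟨le_rfl, hT.le⟩
  have hTT : T ∈ Icc 0 T := ⟨hT.le, le_rfl⟩
  have hab : IntegrableOn (fun s => 2 / ν * (‖toH (y s)‖ * ‖dx (y s)‖)) (Ioo 0 T) := by
    refine ((integrableOn_norm_pow_mul hy 1 1).const_mul (2 / ν)).congr (.of_forall fun s => ?_)
    simp only [pow_one]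
  have ha : IntegrableOn (fun s => ‖toH (y s)‖ ^ 2) (Ioo 0 T) := by
    simpa using integrableOn_norm_pow_mul hy 2 0
  have hb : IntegrableOn (fun s => ‖dx (y s)‖ ^ 2) (Ioo 0 T) := by
    simpa using integrableOn_norm_pow_mul hy 0 2
  have hab2 : IntegrableOn (fun s => 2 / ν * (‖toH (y s)‖ * ‖dx (y s)‖) * ‖dx (y s)‖ ^ 2)
      (Ioo 0 T) := by
    refine ((integrableOn_norm_pow_mul hy 1 3).const_mul (2 / ν)).congr (.of_forall fun s => ?_)
    simp only
    ring
  have h := ae_le_mul_exp_of_ae_le_add_integral hT.le (by positivity) hab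
    (fun t => by positivity) hab2 (ae_sq_norm_dx_le_integral hν hT hu hW hy hz hyz hz0 heq)
  have hβ : ∫ s in (0 : ℝ)..T, 2 / ν * (‖toH (y s)‖ * ‖dx (y s)‖)
      ≤ (T * Real.exp T + (1 + T * Real.exp T) / (2 * ν)) / ν
        * (‖toH y₀‖ ^ 2 + ‖X‖ ^ 2 * normLp 2 T u ^ 2) := by
    have h1 := intervalIntegral_mono_of_integrableOn hab ((ha.add hb).const_mul (1 / ν))
      (.of_forall fun s => by
        simp only [Pi.add_apply]
        rw [div_mul_eq_mul_div, div_mul_eq_mul_div, div_le_div_iff_of_pos_right hν]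
        nlinarith [sq_nonneg (‖toH (y s)‖ - ‖dx (y s)‖)]) hTT
    refine h1.trans ?_
    simp only [Pi.add_apply]
    rw [intervalIntegral.integral_const_mul, intervalIntegral.integral_add
      (intervalIntegrable_of_integrableOn_Ioo ha h0 hTT)
      (intervalIntegrable_of_integrableOn_Ioo hb h0 hTT), div_mul_eq_mul_div, div_mul_eq_mul_div,
      div_le_div_iff_of_pos_right hν]
    have h2 := integral_sq_norm_toH_le hν hT hu hW hy hz hyz hz0 heq
    have h3 := integral_sq_norm_dx_le hν hT hu hW hy hz hyz hz0 heq
    linarith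
  filter_upwards [h] with t ht
  refine ht.trans ?_
  gcongr

end Estimates

/-! ### Assembling the constants. -/

section Main

/-- A square root would halve the exponent; $e^{dQ}\le e^{2dQ}$ is used instead, which keeps the
same $d$. -/
theorem le_of_sq_le_mul_exp {x c S d Q : ℝ} (hc : 0 ≤ c) (hS : 0 ≤ S) (hd : 0 ≤ d) (hQ : 0 ≤ Q)
    (h : x ^ 2 ≤ c * S ^ 2 * Real.exp (d * Q)) : x ≤ √c * S * Real.exp (d * Q) := by
  refine le_of_sq_le_sq (h.trans ?_) (by positivity)
  have h1 : 1 ≤ Real.exp (d * Q) := Real.one_le_exp (by positivity)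
  rw [mul_pow, mul_pow, Real.sq_sqrt hc]
  gcongr
  nlinarith

theorem sq_le_mul_exp_of_estimates {a b k ν E c₁ Y₀ Y₁ U S Q : ℝ} (hν : 0 < ν) (hE : 1 ≤ E)
    (hc₁ : 0 ≤ c₁) (hS : Y₀ ^ 2 + Y₁ ^ 2 + U ^ 2 ≤ S ^ 2) (hQ : Q = U ^ 2 + Y₀ ^ 2)
    (ha : a ^ 2 ≤ (Y₀ ^ 2 + k ^ 2 * U ^ 2) * E)
    (hb : b ^ 2 ≤ (Y₁ ^ 2 + k ^ 2 * U ^ 2 / ν) * Real.exp (c₁ * (Y₀ ^ 2 + k ^ 2 * U ^ 2))) :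
    a ^ 2 + b ^ 2 ≤ ((1 + k ^ 2) * E + 1 + k ^ 2 / ν) * S ^ 2 *
      Real.exp (c₁ * (1 + k ^ 2) * Q) := by
  have hA : Y₀ ^ 2 + k ^ 2 * U ^ 2 ≤ (1 + k ^ 2) * Q := by
    rw [hQ]
    nlinarith [sq_nonneg U, sq_nonneg Y₀, sq_nonneg (k * Y₀)]
  have hQS : Q ≤ S ^ 2 := by nlinarith [sq_nonneg Y₁]
  have hQ0 : 0 ≤ Q := by rw [hQ]; positivity
  have h1 : 1 ≤ Real.exp (c₁ * (1 + k ^ 2) * Q) := Real.one_le_exp (by positivity)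
  have h2 : Real.exp (c₁ * (Y₀ ^ 2 + k ^ 2 * U ^ 2)) ≤ Real.exp (c₁ * (1 + k ^ 2) * Q) := by
    rw [mul_assoc]
    gcongr
  have h3 : a ^ 2 ≤ (1 + k ^ 2) * E * S ^ 2 * Real.exp (c₁ * (1 + k ^ 2) * Q) := by
    calc a ^ 2 ≤ (1 + k ^ 2) * Q * E := ha.trans (by gcongr)
      _ ≤ (1 + k ^ 2) * S ^ 2 * E := by gcongr
      _ = (1 + k ^ 2) * E * S ^ 2 * 1 := by ring
      _ ≤ _ := by gcongr
  have h4 : b ^ 2 ≤ (1 + k ^ 2 / ν) * S ^ 2 * Real.exp (c₁ * (1 + k ^ 2) * Q) := by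
    refine hb.trans ?_
    gcongr
    have h5 : k ^ 2 * U ^ 2 / ν = k ^ 2 / ν * U ^ 2 := by ring
    have h6 : Y₁ ^ 2 ≤ S ^ 2 := by nlinarith [sq_nonneg Y₀, sq_nonneg U]
    have h7 : U ^ 2 ≤ S ^ 2 := by nlinarith [sq_nonneg Y₀, sq_nonneg Y₁]
    have h8 : k ^ 2 / ν * U ^ 2 ≤ k ^ 2 / ν * S ^ 2 := by gcongr
    rw [h5]
    linarith
  linarith

theorem sq_le_three_mul {x p q r : ℝ} (hx : 0 ≤ x) (h : x ≤ p + q + r) :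
    x ^ 2 ≤ 3 * (p ^ 2 + q ^ 2) + 3 * r ^ 2 := by
  have := pow_le_pow_left₀ hx h 2
  nlinarith [sq_nonneg (p - q), sq_nonneg (p - r), sq_nonneg (q - r)]

set_option maxHeartbeats 1000000 in
/-- The a priori estimate, for a weak solution with source term `u(t) X`, `X ∈ L²(ℝ)`. -/
theorem a_priori_estimate {ν T : ℝ} (hν : 0 < ν) (hT : 0 < T) (X : H) :
    ∃ C : ℝ, 0 < C ∧ ∀ (u : ℝ → ℝ) (y₀ : V) (y : ℝ → V) (dy : ℝ → VDual) (z : ℝ → H),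
      MemLp u 2 (timeMeasure T) → MemW T y dy → MemLp y ⊤ (timeMeasure T) →
      ContinuousOn z (Icc 0 T) → (∀ᵐ t ∂timeMeasure T, toH (y t) = z t) → z 0 = toH y₀ →
      (∀ᵐ t ∂timeMeasure T, ∀ φ : V,
        dy t φ + inner ℝ (convection (y t)) (toH φ) + ν * inner ℝ (dx (y t)) (dx φ)
          = u t * inner ℝ X (toH φ)) →
      normLp ⊤ T y + normW T y dy ≤ C * (normLp 2 T u + ‖y₀‖) *
        Real.exp (C * (normLp 2 T u ^ 2 + ‖toH y₀‖ ^ 2)) := by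
  set k := ‖X‖
  set E := Real.exp T
  have hE : 1 ≤ E := Real.one_le_exp hT.le
  set c₁ := (T * E + (1 + T * E) / (2 * ν)) / ν
  have hc₁ : 0 ≤ c₁ := by positivity
  set c₂ := (1 + k ^ 2) * E + 1 + k ^ 2 / ν
  have hc₂ : 0 ≤ c₂ := by positivity
  set c₃ := c₁ * (1 + k ^ 2)
  have hc₃ : 0 ≤ c₃ := by positivity
  -- Of $4T$, one $T$ comes from $\|y\|_{L^2(V)}^2$ and $3T$ from convection in $\partial_ty$;
  -- $3T\nu^2$ is viscous and $3k^2$ the control. The factor 3 is from squaring a sum of three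
  -- terms.
  set c₄ := c₂ * (4 * T + 3 * T * ν ^ 2) + 3 * k ^ 2
  have hc₄ : 0 ≤ c₄ := by positivity
  -- Convection contributes an extra factor $\|y\|_H^2\le AE$; by $x\le e^x$ it is moved into the
  -- exponent, which costs $(1+k^2)E$.
  set c₅ := c₃ + (1 + k ^ 2) * E
  have hc₅ : 0 ≤ c₅ := by positivity
  -- One constant must dominate both the prefactor $\sqrt{c_2}+\sqrt{c_4}$ and the exponent rate
  -- $c_5$; the $1$ makes it positive.
  refine ⟨√c₂ + √c₄ + c₅ + 1, by positivity, ?_⟩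
  intro u y₀ y dy z hu hW hy hz hyz hz0 heq
  set U := normLp 2 T u
  have hU : 0 ≤ U := ENNReal.toReal_nonneg
  set S := U + ‖y₀‖
  have hS0 : 0 ≤ S := by positivity
  set Q := U ^ 2 + ‖toH y₀‖ ^ 2
  have hQ0 : 0 ≤ Q := by positivity
  have hS : ‖toH y₀‖ ^ 2 + ‖dx y₀‖ ^ 2 + U ^ 2 ≤ S ^ 2 := by
    rw [← norm_sq_V]
    nlinarith [norm_nonneg y₀]
  have hUS : U ^ 2 ≤ S ^ 2 := by nlinarith [sq_nonneg ‖toH y₀‖, sq_nonneg ‖dx y₀‖]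
  set A := ‖toH y₀‖ ^ 2 + k ^ 2 * U ^ 2
  have hA : A ≤ (1 + k ^ 2) * Q := by
    simp only [A, Q]
    nlinarith [sq_nonneg U, sq_nonneg (k * ‖toH y₀‖)]
  set m := c₂ * S ^ 2 * Real.exp (c₃ * Q)
  have hm0 : 0 ≤ m := by positivity
  have hae := ae_sq_norm_toH_le hν hT hu hW hy hz hyz hz0 heq
  have hbe := ae_sq_norm_dx_le hν hT hu hW hy hz hyz hz0 heq
  have hV : ∀ᵐ t ∂timeMeasure T, ‖y t‖ ^ 2 ≤ m := by
    filter_upwards [hae, hbe] with t h1 h2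
    rw [norm_sq_V]
    exact sq_le_mul_exp_of_estimates hν hE hc₁ hS rfl h1 h2
  have hexp : Real.exp (c₃ * Q) ≤ Real.exp (c₅ * Q) := by
    gcongr
    exact le_add_of_nonneg_right (by positivity)
  have hsup : normLp ⊤ T y ≤ √c₂ * S * Real.exp (c₅ * Q) := by
    refine normLp_top_le (by positivity) ?_
    filter_upwards [hV] with t ht
    refine le_of_sq_le_mul_exp hc₂ hS0 hc₅ hQ0 (ht.trans ?_)
    simp only [m]
    gcongr
  have hdual : ∀ᵐ t ∂timeMeasure T,
      ‖dy t‖ ^ 2 ≤ 3 * (A * E * m + ν ^ 2 * m) + 3 * k ^ 2 * ‖u t‖ ^ 2 := by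
    filter_upwards [hae, hV, heq] with t h1 h2 h3
    have h4 := norm_le_of_equation hν.le h3
    have h5 : ‖dx (y t)‖ ^ 2 ≤ m := (pow_le_pow_left₀ (norm_nonneg _) (norm_dx_le _) 2).trans h2
    have h6 : (‖toH (y t)‖ * ‖dx (y t)‖) ^ 2 ≤ A * E * m := by
      rw [mul_pow]
      gcongr
    have h7 : (ν * ‖dx (y t)‖) ^ 2 ≤ ν ^ 2 * m := by
      rw [mul_pow]
      gcongr
    have h8 : (k * |u t|) ^ 2 = k ^ 2 * ‖u t‖ ^ 2 := by rw [mul_pow, Real.norm_eq_abs]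
    refine (sq_le_three_mul (norm_nonneg _) h4).trans ?_
    rw [h8, ← mul_assoc]
    gcongr
  have h0 : (0 : ℝ) ∈ Icc 0 T := ⟨le_rfl, hT.le⟩
  have hTT : T ∈ Icc 0 T := ⟨hT.le, le_rfl⟩
  have hcst (c : ℝ) : IntegrableOn (fun _ : ℝ => c) (Ioo 0 T) := integrableOn_const (by simp)
  have hyL : normLp 2 T y ^ 2 ≤ T * m := by
    rw [sq_normLp_two hT.le hW.memLp]
    refine (intervalIntegral_mono_of_integrableOn (integrableOn_norm_sq hW.memLp)
      (hcst m) hV hTT).trans (le_of_eq ?_)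
    rw [intervalIntegral.integral_const, sub_zero, smul_eq_mul]
  have hdL : normLp 2 T dy ^ 2 ≤ T * (3 * (A * E * m + ν ^ 2 * m)) + 3 * k ^ 2 * U ^ 2 := by
    have hu2 : IntegrableOn (fun t => 3 * k ^ 2 * ‖u t‖ ^ 2) (Ioo 0 T) :=
      (integrableOn_norm_sq hu).const_mul _
    rw [sq_normLp_two hT.le hW.memLp_deriv]
    refine (intervalIntegral_mono_of_integrableOn (integrableOn_norm_sq hW.memLp_deriv)
      ((hcst (3 * (A * E * m + ν ^ 2 * m))).add hu2) hdual hTT).trans (le_of_eq ?_)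
    simp only [Pi.add_apply]
    rw [intervalIntegral.integral_add intervalIntegrable_const
      (intervalIntegrable_of_integrableOn_Ioo hu2 h0 hTT), intervalIntegral.integral_const,
      sub_zero, smul_eq_mul, intervalIntegral.integral_const_mul, ← sq_normLp_two hT.le hu]
  have hAE : A * E ≤ Real.exp ((1 + k ^ 2) * E * Q) := by
    have h1 : A * E ≤ (1 + k ^ 2) * Q * E := by gcongr
    have h2 := Real.add_one_le_exp ((1 + k ^ 2) * E * Q)
    linarith
  set M := c₂ * S ^ 2 * Real.exp (c₅ * Q)
  have hmM : m ≤ M := by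
    simp only [m, M]
    gcongr
  have hAM : A * E * m ≤ M := by
    have h1 : M = Real.exp ((1 + k ^ 2) * E * Q) * m := by
      have h2 : Real.exp (c₅ * Q) = Real.exp (c₃ * Q) * Real.exp ((1 + k ^ 2) * E * Q) := by
        rw [← Real.exp_add, ← add_mul]
      simp only [M, m, h2]
      ring
    rw [h1]
    gcongr
  have hUM : U ^ 2 ≤ S ^ 2 * Real.exp (c₅ * Q) := by
    have h1 : 1 ≤ Real.exp (c₅ * Q) := Real.one_le_exp (by positivity)
    nlinarith [sq_nonneg S]
  have hnW : normW T y dy ≤ √c₄ * S * Real.exp (c₅ * Q) := by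
    refine le_of_sq_le_mul_exp hc₄ hS0 hc₅ hQ0 ?_
    rw [normW, Real.sq_sqrt (by positivity)]
    calc normLp 2 T y ^ 2 + normLp 2 T dy ^ 2
        ≤ T * m + (T * (3 * (A * E * m + ν ^ 2 * m)) + 3 * k ^ 2 * U ^ 2) := add_le_add hyL hdL
      _ ≤ T * M + (T * (3 * (M + ν ^ 2 * M)) + 3 * k ^ 2 * (S ^ 2 * Real.exp (c₅ * Q))) := by
          gcongr
      _ = c₄ * S ^ 2 * Real.exp (c₅ * Q) := by
          simp only [M, c₄]
          ring
  have hs2 := Real.sqrt_nonneg c₂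
  have hs4 := Real.sqrt_nonneg c₄
  have hC₁ : √c₂ + √c₄ ≤ √c₂ + √c₄ + c₅ + 1 := by linarith
  have hC₂ : c₅ ≤ √c₂ + √c₄ + c₅ + 1 := by linarith
  calc normLp ⊤ T y + normW T y dy
      ≤ (√c₂ + √c₄) * S * Real.exp (c₅ * Q) := by linarith
    _ ≤ (√c₂ + √c₄ + c₅ + 1) * S * Real.exp ((√c₂ + √c₄ + c₅ + 1) * Q) := by
        gcongr

end Main

end Burgers

end

theorem mainTheorem7 (ν T : ℝ) (hν : 0 < ν) (hT : 0 < T)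
    (χ : ℝ → ℝ) (hχ : ContDiff ℝ ∞ χ) (hχc : HasCompactSupport χ) :
    ∃ C : ℝ, 0 < C ∧
      ∀ (u : ℝ → ℝ) (y₀ : Burgers.V) (y : ℝ → Burgers.V) (dy : ℝ → Burgers.VDual),
        Burgers.MemH1Time T u →
        Burgers.HasBoundedSupport y₀ →
        Burgers.MemW T y dy →
        MemLp y ⊤ (Burgers.timeMeasure T) →
        Burgers.IsWeakSolution ν T χ u y₀ y →
        Burgers.normLp ⊤ T y + Burgers.normW T y dy
          ≤ C * (Burgers.normLp 2 T u + ‖y₀‖) *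
              Real.exp (C * (Burgers.normLp 2 T u ^ 2 + ‖Burgers.toH y₀‖ ^ 2)) := by
  have hχ2 : MemLp χ 2 volume := hχ.continuous.memLp_of_hasCompactSupport hχc
  obtain ⟨C, hC, h⟩ := Burgers.a_priori_estimate hν hT (hχ2.toLp χ)
  refine ⟨C, hC, fun u y₀ y dy hu _ hW hy hsol => ?_⟩
  obtain ⟨z, hz, hyz, hz0⟩ := hsol.initial
  exact h u y₀ y dy z hu.1 hW hy hz hyz (ext_inner_right ℝ hz0) (hsol.ae_equation hW hχ2)
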